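/- Let $V$ be a finite set of $n \ge 3$ cities, let $E$ be the edge set of the complete undirected graph on $V$, and let $c : E \to \{1,2\}$ be arbitrary edge costs (a 1,2-TSP instance). For $S \subseteq V$ let $\delta(S)$ be the set of edges with exactly one endpoint in $S$, and write $\delta(i)=\delta(\{i\})$. A tour is a Hamiltonian cycle of the complete graph; its cost is the sum of the costs of its edges. Let $OPT(c)$ be the minimum cost of a tour, and let $SUBT(c)$ be the optimal value of the subtour LP $$\min \sum_{e\in E} c(e)x(e)\quad\text{subject to}\quad \sum_{e\in\delta(i)}x(e)=2\ (i\in V),\qquad \sum_{e\in\delta(S)}x(e)\ge 2\ (S\subset V,\ 3\le |S|\le n-3),\qquad 0\le x(e)\le 1\ (e\in E).$$ Then both minima are attained, and $$OPT(c)\ \le\ \frac{19}{15}\,SUBT(c).$$ That is, the integrality gap of the subtour LP is at most $\frac{19}{15}$ for the 1,2-TSP. -/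

import Mathlib

namespace OneTwoTSP

variable {V : Type*} [Fintype V] [DecidableEq V]

/-- The edge set of the complete undirected graph on the set of cities `V`. -/
abbrev edges (V : Type*) [Fintype V] [DecidableEq V] : Finset (Sym2 V) :=
  (⊤ : SimpleGraph V).edgeFinset

/-- `cut S` is the set `δ(S)` of all edges with exactly one endpoint in `S`. -/
def cut (S : Finset V) : Finset (Sym2 V) :=
  (edges V).filter fun e => ∃ i ∈ S, ∃ j ∉ S, e = s(i, j)

/-- The cost of a closed walk in the complete graph: the sum of its edge costs. -/
def walkCost (c : Sym2 V → ℝ) {v : V} (p : (⊤ : SimpleGraph V).Walk v v) : ℝ :=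
  (p.edges.map c).sum

/-- The costs of all tours; a tour is a Hamiltonian cycle of the complete graph. -/
def tourCosts (c : Sym2 V → ℝ) : Set ℝ :=
  {t | ∃ (v : V) (p : (⊤ : SimpleGraph V).Walk v v), p.IsHamiltonianCycle ∧ walkCost c p = t}

/-- Feasibility for the subtour LP.  Only the values of `x` on edges matter: the values on the
diagonal of `Sym2 V` are not constrained and do not enter the objective. -/
structure IsSubtourFeasible (x : Sym2 V → ℝ) : Prop where
  degree : ∀ i : V, ∑ e ∈ cut {i}, x e = 2
  subtour : ∀ S : Finset V, 3 ≤ S.card → S.card + 3 ≤ Fintype.card V → 2 ≤ ∑ e ∈ cut S, x e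
  bounds : ∀ e ∈ edges V, 0 ≤ x e ∧ x e ≤ 1

/-- The objective function of the subtour LP. -/
def lpCost (c x : Sym2 V → ℝ) : ℝ := ∑ e ∈ edges V, c e * x e

/-- The objective values of all feasible solutions of the subtour LP. -/
def lpValues (c : Sym2 V → ℝ) : Set ℝ :=
  {t | ∃ x : Sym2 V → ℝ, IsSubtourFeasible x ∧ lpCost c x = t}

/-- The cost of an optimal tour. -/
noncomputable def optTour (c : Sym2 V → ℝ) : ℝ := sInf (tourCosts c)

/-- The optimal value of the subtour LP. -/
noncomputable def optSubtour (c : Sym2 V → ℝ) : ℝ := sInf (lpValues c)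

end OneTwoTSP

/-!
Let `G` be the graph of the edges of cost `1`. A solution of the subtour LP is a fractional tour; if
it puts weight `t` on the edges of cost `2`, its value is `n + t`. An ordering of the cities with
`b` breaks, that is, `b` consecutive pairs not adjacent in `G`, gives a tour of cost at most
`n + b + 1`, so it suffices to find one with `15 (b + 1) ≤ 4 n + 19 t`.

Add `T = ⌊t⌋` universal vertices to `G`. By the cut constraints the resulting graph is 1-tough, and
hence by Tutte's theorem it has a perfect matching (up to one vertex if `n + T` is odd, which then
forms a path by itself). Double counting the weight at the ends of these paths with the degree
constraints shows that the ends satisfy a Hall type condition; by Tutte's theorem again there is a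
second matching, between ends of different paths, that covers an end of every path. It allows the
paths to be concatenated into chains of at least two paths each. Traversing the chains one after
another and deleting the new vertices, each of which costs at most one break, gives
`4 (b + 1) ≤ n + 5 T` unless `n` is odd and `t < 1`. In that case a rounding error remains; it is
paid for by `t` unless `t` is of order at most `1 / n`, and then the vertex missed by the matching
is attached along an edge of large weight, which avoids the error.
-/

namespace OneTwoTSP

/-! ### Tough graphs and matchings -/

section Matching

variable {W : Type*}

/-- A labelling of the vertices outside `S` that is constant on the components of `G - S`. The
number of labels it uses is a lower bound for the number of components, attained by labelling every
vertex with a representative of its component. -/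
def IsComponentLabelling {κ : Type*} (G : SimpleGraph W) (S : Finset W) (f : W → κ) : Prop :=
  ∀ ⦃u v⦄, u ∉ S → v ∉ S → G.Adj u v → f u = f v

lemma exists_isComponentLabelling_card_connectedComponent_le [Fintype W] [DecidableEq W]
    (G : SimpleGraph W) (S : Finset W) :
    ∃ f : W → W, IsComponentLabelling G S f ∧
      Nat.card ((⊤ : G.Subgraph).deleteVerts S).coe.ConnectedComponent ≤ (Sᶜ.image f).card := by
  classical
  set H := ((⊤ : G.Subgraph).deleteVerts S).coe with hH
  have hmem {w : W} (hw : w ∉ S) : w ∈ ((⊤ : G.Subgraph).deleteVerts S).verts := by simpa using hw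
  let f (w : W) : W := if hw : w ∉ S then (H.connectedComponentMk ⟨w, hmem hw⟩).out.1 else w
  refine ⟨f, fun u v hu hv huv => ?_, ?_⟩
  · have hadj : H.Adj ⟨u, hmem hu⟩ ⟨v, hmem hv⟩ := by
      simp [hH, SimpleGraph.Subgraph.coe_adj, hu, hv, huv]
    simp only [f, dif_pos hu, dif_pos hv,
      SimpleGraph.ConnectedComponent.connectedComponentMk_eq_of_adj hadj]
  · rw [Nat.card_eq_fintype_card, ← Finset.card_univ]
    refine Finset.card_le_card_of_injOn (fun C => C.out.1) (fun C _ => ?_) fun C _ D _ hCD => ?_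
    · have hC : C.out.1 ∉ S := by simpa using C.out.2
      refine Finset.mem_coe.2 (Finset.mem_image.2 ⟨C.out.1, Finset.mem_compl.2 hC, ?_⟩)
      simp only [f, dif_pos hC]
      exact congrArg (fun D : H.ConnectedComponent => D.out.1) (Quot.out_eq C)
    · rw [← Quot.out_eq C, ← Quot.out_eq D, Subtype.ext hCD]

lemma even_ncard_oddComponents_deleteVerts_add [Finite W] (G : SimpleGraph W)
    (heven : Even (Nat.card W)) (S : Set W) :
    Even (((⊤ : G.Subgraph).deleteVerts S).coe.oddComponents.ncard + S.ncard) := by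
  have hverts : ((⊤ : G.Subgraph).deleteVerts S).verts = Sᶜ := by ext; simp
  have hcard : Nat.card ((⊤ : G.Subgraph).deleteVerts S).verts + S.ncard = Nat.card W := by
    rw [Nat.card_coe_set_eq, hverts, add_comm, Set.ncard_add_ncard_compl]
  rw [← hcard, ← Nat.not_odd_iff_even, Nat.odd_add] at heven
  rwa [← Nat.not_odd_iff_even, Nat.odd_add, SimpleGraph.odd_ncard_oddComponents]

/-- By parity, a Tutte violator `S` leaves at least `|S| + 2` components. -/
theorem exists_perfectMatching [Fintype W] [DecidableEq W] {G : SimpleGraph W}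
    (heven : Even (Fintype.card W))
    (h : ∀ (S : Finset W) (f : W → W), IsComponentLabelling G S f →
      (Sᶜ.image f).card ≤ S.card + 1) :
    ∃ σ : W → W, ∀ w, G.Adj w (σ w) ∧ σ (σ w) = w := by
  classical
  have hperfect : ∃ M : G.Subgraph, M.IsPerfectMatching := by
    refine SimpleGraph.tutte.2 fun S hviolator => ?_
    unfold SimpleGraph.IsTutteViolator at hviolator
    obtain ⟨f, hf, hcomp⟩ := exists_isComponentLabelling_card_connectedComponent_le G S.toFinset
    have hodd := even_ncard_oddComponents_deleteVerts_add G
      (by rwa [Nat.card_eq_fintype_card]) S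
    rw [Set.coe_toFinset] at hcomp
    have hle := Set.ncard_le_card ((⊤ : G.Subgraph).deleteVerts S).coe.oddComponents
    have hS := h _ f hf
    rw [← Set.ncard_eq_toFinset_card'] at hS
    obtain ⟨k, hk⟩ := hodd
    omega
  obtain ⟨M, hM⟩ := hperfect
  choose σ hσ huniq using fun w => hM.1 (hM.2 w)
  exact ⟨σ, fun w => ⟨M.adj_sub (hσ w), (huniq (σ w) w (hσ w).symm).symm⟩⟩

/-- A 1-tough graph: the removal of a set `S` of at least one vertex leaves at most `|S|`
components, and the graph itself is connected. -/
def IsOneTough [Fintype W] [DecidableEq W] (G : SimpleGraph W) : Prop :=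
  ∀ (S : Finset W) (f : W → W), IsComponentLabelling G S f → (Sᶜ.image f).card ≤ max 1 S.card

/-- `σ` is a matching of `G` that covers exactly the vertices outside `X`, given as the map to
matching partners; its values on `X` are irrelevant. -/
def IsMatchingOff (G : SimpleGraph W) (X : Set W) (σ : W → W) : Prop :=
  ∀ u ∉ X, σ u ∉ X ∧ G.Adj u (σ u) ∧ σ (σ u) = u

namespace IsOneTough

lemma exists_isMatchingOff_empty [Fintype W] [DecidableEq W] {G : SimpleGraph W}
    (h : IsOneTough G) (heven : Even (Fintype.card W)) : ∃ σ, IsMatchingOff G ∅ σ := by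
  obtain ⟨σ, hσ⟩ := exists_perfectMatching heven fun S f hf => (h S f hf).trans (by omega)
  exact ⟨σ, fun u _ => ⟨Set.notMem_empty _, hσ u⟩⟩

lemma card_image_le_card_add_one_of_comap_ne [Fintype W] [DecidableEq W] {G : SimpleGraph W}
    (h : IsOneTough G) (x : W) {S : Finset {y // y ≠ x}} {f : {y // y ≠ x} → {y // y ≠ x}}
    (hf : IsComponentLabelling (G.comap Subtype.val) S f) : (Sᶜ.image f).card ≤ S.card + 1 := by
  set S' : Finset W := insert x (S.map (Function.Embedding.subtype _)) with hS'
  have hmem {u : W} (hu : u ∉ S') : ∃ hux : u ≠ x, ⟨u, hux⟩ ∉ S := by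
    simp only [hS', Finset.mem_insert, Finset.mem_map, Function.Embedding.coe_subtype, not_or,
      not_exists, not_and] at hu
    exact ⟨hu.1, fun h => hu.2 _ h rfl⟩
  have hlabel : IsComponentLabelling G S' fun u => if hu : u ≠ x then (f ⟨u, hu⟩ : W) else u := by
    intro u v hu hv huv
    obtain ⟨hux, huS⟩ := hmem hu
    obtain ⟨hvx, hvS⟩ := hmem hv
    simp only [dif_pos hux, dif_pos hvx, hf huS hvS huv]
  have hcard : S'.card = S.card + 1 := by
    rw [hS', Finset.card_insert_of_notMem (by simp), Finset.card_map]
  calc (Sᶜ.image f).card = ((Sᶜ.image f).map (Function.Embedding.subtype _)).card := by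
        rw [Finset.card_map]
    _ ≤ _ := Finset.card_le_card fun v hv => ?_
    _ ≤ max 1 S'.card := h _ _ hlabel
    _ = S.card + 1 := by omega
  simp only [Finset.mem_map, Finset.mem_image, Finset.mem_compl] at hv
  obtain ⟨-, ⟨u, hu, rfl⟩, rfl⟩ := hv
  refine Finset.mem_image.2 ⟨u, Finset.mem_compl.2 ?_, dif_pos u.2⟩
  simpa [hS', u.2] using hu

lemma exists_isMatchingOff_singleton [Fintype W] [DecidableEq W] {G : SimpleGraph W}
    (h : IsOneTough G) (hodd : Odd (Fintype.card W)) (x : W) : ∃ σ, IsMatchingOff G {x} σ := by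
  have heven : Even (Fintype.card {y // y ≠ x}) := by
    rw [Fintype.card_subtype_compl, Fintype.card_subtype_eq]
    exact hodd.tsub_odd odd_one
  obtain ⟨σ, hσ⟩ := exists_perfectMatching (G := G.comap Subtype.val) heven
    fun _ _ => card_image_le_card_add_one_of_comap_ne h x
  refine ⟨fun u => if hu : u ≠ x then σ ⟨u, hu⟩ else u, fun u hu => ?_⟩
  rw [Set.mem_singleton_iff] at hu
  simpa [hu, (σ ⟨u, hu⟩).2] using ⟨(hσ ⟨u, hu⟩).1, congrArg Subtype.val (hσ ⟨u, hu⟩).2⟩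

end IsOneTough

end Matching

/-! ### Linkings -/

section Linking

variable {I : Type*}

lemma two_mul_card_image_le {α β : Type*} [DecidableEq α] [DecidableEq β] (U : Finset α)
    (g : α → β) :
    2 * (U.image g).card ≤ U.card + {s ∈ U | ∀ s' ∈ U, g s' = g s → s' = s}.card := by
  set A := {s ∈ U | ∀ s' ∈ U, g s' = g s → s' = s} with hA
  have hmaps : ∀ s ∈ A, g s ∈ U.image g := fun s hs =>
    Finset.mem_image_of_mem g (Finset.mem_filter.1 hs).1
  rw [Finset.card_eq_sum_card_image g U, Finset.card_eq_sum_card_fiberwise hmaps,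
    ← Finset.sum_add_distrib, mul_comm, ← smul_eq_mul]
  refine Finset.card_nsmul_le_sum _ _ _ fun y hy => ?_
  have hpos : 0 < {s ∈ U | g s = y}.card := by
    obtain ⟨s, hs, rfl⟩ := Finset.mem_image.1 hy
    exact Finset.card_pos.2 ⟨s, Finset.mem_filter.2 ⟨hs, rfl⟩⟩
  suffices hone : {s ∈ U | g s = y}.card = 1 → 0 < {s ∈ A | g s = y}.card by omega
  intro hone
  obtain ⟨s, hs⟩ := Finset.card_eq_one.1 hone
  have hmem : ∀ s', s' ∈ U ∧ g s' = y ↔ s' = s := by simpa [Finset.ext_iff] using hs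
  obtain ⟨hsU, rfl⟩ := (hmem s).2 rfl
  exact Finset.card_pos.2 ⟨s, by
    simpa [hA, hsU] using fun s' hs' hss' => (hmem s').1 ⟨hs', hss'⟩⟩

/-- A matching of `H`, a graph on the ends of the paths indexed by `I`, that covers at least one end
of every path. The two ends of path `i` are `(i, false)` and `(i, true)`. -/
structure IsLinking (H : SimpleGraph (I × Bool)) (σ : I × Bool → Option (I × Bool)) : Prop where
  adj : ∀ {s s'}, σ s = some s' → H.Adj s s'
  symm : ∀ {s s'}, σ s = some s' → σ s' = some s
  exists_eq_some : ∀ i, ∃ b s, σ (i, b) = some s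

/-- A Hall type condition on the neighbourhoods in `H` that guarantees a linking. -/
def LinkingCondition (H : SimpleGraph (I × Bool)) : Prop :=
  ∀ A : Finset (I × Bool), A.card ≤ 2 * {s | ∃ a ∈ A, H.Adj a s}.ncard + 1

/-- A graph whose perfect matchings yield linkings of `H`: the two ends of path `i` are joined to an
auxiliary vertex, so at most one of them is matched to it, and the auxiliary vertices form a clique,
padded by `k` further vertices to make the order even. -/
def linkingGadget (H : SimpleGraph (I × Bool)) (k : ℕ) :
    SimpleGraph ((I × Bool) ⊕ (I ⊕ Fin k)) where
  Adj
    | .inl s, .inl s' => H.Adj s s'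
    | .inl s, .inr z => z = .inl s.1
    | .inr z, .inl s => z = .inl s.1
    | .inr z, .inr z' => z ≠ z'
  symm := ⟨by
    rintro (s | z) (s' | z') h
    exacts [H.adj_symm h, h, h, h.symm]⟩
  loopless := ⟨by
    rintro (s | z) h
    exacts [H.loopless.irrefl _ h, h rfl]⟩

lemma IsComponentLabelling.card_image_inr_le_one [Fintype I] [DecidableEq I]
    {H : SimpleGraph (I × Bool)} {k : ℕ} {κ : Type*} [DecidableEq κ]
    {S : Finset ((I × Bool) ⊕ (I ⊕ Fin k))} {f : (I × Bool) ⊕ (I ⊕ Fin k) → κ}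
    (hf : IsComponentLabelling (linkingGadget H k) S f) :
    (S.toRightᶜ.image (f ∘ .inr)).card ≤ 1 := by
  simp only [Finset.card_le_one, Finset.forall_mem_image, Finset.mem_compl, Finset.mem_toRight]
  intro z hz z' hz'
  by_cases hzz : z = z'
  · rw [hzz]
  · exact hf hz hz' hzz

lemma LinkingCondition.card_image_linkingGadget_le [Fintype I] [DecidableEq I]
    {H : SimpleGraph (I × Bool)} (hH : LinkingCondition H) {k : ℕ} {κ : Type*} [DecidableEq κ]
    {S : Finset ((I × Bool) ⊕ (I ⊕ Fin k))} {f : (I × Bool) ⊕ (I ⊕ Fin k) → κ}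
    (hf : IsComponentLabelling (linkingGadget H k) S f) : (Sᶜ.image f).card ≤ S.card + 1 := by
  set Z := S.toRightᶜ.image (f ∘ Sum.inr) with hZ
  set U := {s : I × Bool | Sum.inl s ∉ S ∧ f (.inl s) ∉ Z}.toFinset with hU
  set A := {s ∈ U | ∀ s' ∈ U, f (.inl s') = f (.inl s) → s' = s} with hA
  have hZ_card : Z.card ≤ 1 := hf.card_image_inr_le_one
  have hsubset : Sᶜ.image f ⊆ U.image (f ∘ .inl) ∪ Z := by
    simp only [Finset.image_subset_iff, Finset.mem_compl, Finset.mem_union]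
    rintro (s | z) h
    · by_cases hs : f (.inl s) ∈ Z
      · exact Or.inr hs
      · exact Or.inl (Finset.mem_image.2 ⟨s, by simp [hU, h, hs], rfl⟩)
    · exact Or.inr (Finset.mem_image.2 ⟨z, by simpa using h, rfl⟩)
  have hU_subset : U ⊆ S.toRight.toLeft ×ˢ Finset.univ := by
    intro s hs
    simp only [hU, hZ, Set.mem_toFinset, Set.mem_ofPred_eq, Finset.mem_image, Finset.mem_compl,
      Finset.mem_toRight, not_exists, not_and, Function.comp_apply] at hs
    simp only [Finset.mem_product, Finset.mem_toLeft, Finset.mem_toRight, Finset.mem_univ, and_true]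
    by_contra hmem
    exact hs.2 (.inl s.1) hmem (hf hs.1 hmem rfl).symm
  have hA_neighbors : {s | ∃ a ∈ A, H.Adj a s} ⊆ S.toLeft := by
    rintro s ⟨a, ha, has⟩
    simp only [hA, hU, Finset.mem_filter, Set.mem_toFinset, Set.mem_ofPred_eq] at ha
    by_contra hmem
    have hmem : Sum.inl s ∉ S := by simpa using hmem
    have hlabel : f (.inl a) = f (.inl s) := hf ha.1.1 hmem has
    exact has.ne (ha.2 s ⟨hmem, hlabel ▸ ha.1.2⟩ hlabel.symm).symm
  have hD := two_mul_card_image_le U (f ∘ .inl)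
  have hU_card := Finset.card_le_card hU_subset
  have hA_card := hH A
  have hN_card := Set.ncard_le_ncard hA_neighbors
  have hS := S.card_toLeft_add_card_toRight
  have hSR := S.toRight.card_toLeft_add_card_toRight
  have hle := (Finset.card_le_card hsubset).trans (Finset.card_union_le _ _)
  rw [Set.ncard_coe_finset] at hN_card
  rw [Finset.card_product, Finset.card_univ, Fintype.card_bool] at hU_card
  simp only [Function.comp_apply, ← hA] at hD
  omega

theorem LinkingCondition.exists_isLinking [Finite I] {H : SimpleGraph (I × Bool)}
    (hH : LinkingCondition H) : ∃ σ, IsLinking H σ := by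
  classical
  cases nonempty_fintype I
  have heven : Even (Fintype.card ((I × Bool) ⊕ (I ⊕ Fin (Fintype.card I % 2)))) := by
    simp only [Fintype.card_sum, Fintype.card_prod, Fintype.card_bool, Fintype.card_fin]
    rw [Nat.even_iff]
    omega
  obtain ⟨τ, hτ⟩ := exists_perfectMatching heven fun S f => hH.card_image_linkingGadget_le
  refine ⟨fun s => (τ (.inl s)).getLeft?, fun {s s'} hs => ?_, fun {s s'} hs => ?_, fun i => ?_⟩
  · rw [Sum.getLeft?_eq_some_iff] at hs
    have h := (hτ (.inl s)).1
    rwa [hs] at h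
  · rw [Sum.getLeft?_eq_some_iff] at hs ⊢
    rw [← hs, (hτ _).2]
  · by_contra hnone
    have haux (b : Bool) : τ (.inl (i, b)) = .inr (.inl i) := by
      have hadj := (hτ (.inl (i, b))).1
      rcases hb : τ (.inl (i, b)) with s | z
      · exact absurd ⟨b, s, by simp [hb]⟩ hnone
      · rw [hb] at hadj
        exact congrArg _ hadj
    have hboth := (hτ (.inl (i, true))).2
    rw [haux, ← haux false, (hτ _).2] at hboth
    simp at hboth

end Linking

/-! ### Chain covers -/

/-- A duplicate-free list of all elements of a type. -/
structure IsEnumeration {α : Type*} (l : List α) : Prop where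
  nodup : l.Nodup
  mem : ∀ a, a ∈ l

namespace IsEnumeration

variable {α : Type*} {l l' : List α}

lemma perm (h : IsEnumeration l) (hl : l.Perm l') : IsEnumeration l' :=
  ⟨hl.nodup_iff.1 h.nodup, fun a => hl.mem_iff.1 (h.mem a)⟩

lemma length_eq [Fintype α] (h : IsEnumeration l) : l.length = Fintype.card α := by
  classical
  have huniv : l.toFinset = Finset.univ := Finset.eq_univ_iff_forall.2 (by simpa using h.mem)
  rw [← List.toFinset_card_of_nodup h.nodup, huniv, Finset.card_univ]

end IsEnumeration

section ChainCover

variable {I : Type*}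

/-- The other end of the path that has end `s`. -/
def otherEnd (s : I × Bool) : I × Bool := (s.1, !s.2)

@[simp] lemma otherEnd_fst (s : I × Bool) : (otherEnd s).1 = s.1 := rfl

@[simp] lemma otherEnd_otherEnd (s : I × Bool) : otherEnd (otherEnd s) = s := by
  simp [otherEnd]

/-- `o` and `o'` are the ends at which two oriented paths start; the second path can be traversed
right after the first, because `σ` matches the last end of the first one to `o'`. -/
def Follows (σ : I × Bool → Option (I × Bool)) (o o' : I × Bool) : Prop :=
  σ (otherEnd o) = some o'

/-- A family of chains of oriented paths, consecutive ones being linked by `σ`, in which every path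
occurs exactly once. An oriented path is represented by the end at which it starts. -/
structure IsChainCover (σ : I × Bool → Option (I × Bool)) (𝓛 : List (List (I × Bool))) :
    Prop where
  ne_nil : ∀ c ∈ 𝓛, c ≠ []
  isChain : ∀ c ∈ 𝓛, c.IsChain (Follows σ)
  isEnumeration : IsEnumeration (𝓛.flatten.map Prod.fst)

lemma exists_isChainCover [Finite I] (σ : I × Bool → Option (I × Bool)) :
    ∃ 𝓛, IsChainCover σ 𝓛 := by
  cases nonempty_fintype I
  refine ⟨(Finset.univ : Finset I).toList.map fun i => [(i, true)], by simp, by simp, ?_⟩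
  have hmap : (((Finset.univ : Finset I).toList.map fun i => [(i, true)]).flatten.map Prod.fst)
      = (Finset.univ : Finset I).toList := by
    simp [← List.flatMap_def, List.map_flatMap]
  rw [hmap]
  exact ⟨Finset.nodup_toList _, by simp⟩

namespace IsChainCover

variable {σ : I × Bool → Option (I × Bool)} {𝓛 L₁ L₂ : List (List (I × Bool))}

lemma replace (h : IsChainCover σ 𝓛) (h𝓛 : 𝓛.Perm (L₁ ++ L₂)) {m : List (I × Bool)}
    (hne : m ≠ []) (hchain : m.IsChain (Follows σ))
    (hm : (m.map Prod.fst).Perm (L₁.flatten.map Prod.fst)) : IsChainCover σ (m :: L₂) := by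
  have hmem : ∀ c ∈ L₂, c ∈ 𝓛 := fun c hc => h𝓛.mem_iff.2 (List.mem_append_right _ hc)
  refine ⟨?_, ?_, h.isEnumeration.perm ?_⟩
  · exact List.forall_mem_cons.2 ⟨hne, fun c hc => h.ne_nil c (hmem c hc)⟩
  · exact List.forall_mem_cons.2 ⟨hchain, fun c hc => h.isChain c (hmem c hc)⟩
  · refine (h𝓛.flatten.map Prod.fst).trans ?_
    simpa only [List.flatten_append, List.flatten_cons, List.map_append] using
      hm.symm.append_right _

lemma sum_length [Fintype I] (h : IsChainCover σ 𝓛) :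
    (𝓛.map List.length).sum = Fintype.card I := by
  rw [← h.isEnumeration.length_eq, List.length_map, List.length_flatten]

lemma exists_mem (h : IsChainCover σ 𝓛) (i : I) : ∃ c ∈ 𝓛, ∃ b, (i, b) ∈ c := by
  obtain ⟨⟨i, b⟩, hib, rfl⟩ := List.mem_map.1 (h.isEnumeration.mem i)
  obtain ⟨c, hc, hbc⟩ := List.mem_flatten.1 hib
  exact ⟨c, hc, b, hbc⟩

end IsChainCover

lemma two_mul_length_le_sum_length {α : Type*} {L : List (List α)} (h : ∀ c ∈ L, 2 ≤ c.length) :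
    2 * L.length ≤ (L.map List.length).sum := by
  simpa [mul_comm] using List.card_nsmul_le_sum (L.map List.length) 2 (by simpa using h)

namespace IsLinking

variable {H : SimpleGraph (I × Bool)} {σ : I × Bool → Option (I × Bool)}

lemma isChain_reverse (hσ : IsLinking H σ) {c : List (I × Bool)} (hc : c.IsChain (Follows σ)) :
    (c.map otherEnd).reverse.IsChain (Follows σ) := by
  rw [List.isChain_reverse, List.isChain_map]
  refine hc.imp fun o o' ho => ?_
  rw [Follows, otherEnd_otherEnd]
  exact hσ.symm ho

lemma exists_isChain_cons (hσ : IsLinking H σ) {i j : I} {b d e : Bool}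
    (hij : σ (i, b) = some (j, d)) {c : List (I × Bool)} (hc : c.IsChain (Follows σ))
    (hj : (j, e) ∈ c) (hi : i ∉ c.map Prod.fst) :
    ∃ m : List (I × Bool), m.IsChain (Follows σ) ∧
      (m.map Prod.fst).Perm (i :: c.map Prod.fst) := by
  wlog hed : e = d generalizing c e
  · have hj' : otherEnd (j, e) ∈ (c.map otherEnd).reverse := by simpa using List.mem_map_of_mem hj
    have hed' : (!e) = d := by cases e <;> cases d <;> simp_all
    obtain ⟨m, hm, hperm⟩ := this (hσ.isChain_reverse hc) hj' (by simpa using hi) hed'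
    exact ⟨m, hm, hperm.trans (by simp [Function.comp_def])⟩
  subst hed
  obtain ⟨p, q, rfl⟩ := List.append_of_mem hj
  obtain rfl : p = [] := by
    rcases List.eq_nil_or_concat p with hp | ⟨p, o, rfl⟩
    · exact hp
    · have ho : Follows σ o (j, e) := by
        rw [List.concat_eq_append, List.append_assoc] at hc
        simpa using (List.isChain_cons_cons.1 hc.right_of_append).1
      have hoi : (i, b) = otherEnd o :=
        Option.some_injective _ ((hσ.symm hij).symm.trans (hσ.symm ho))
      exact absurd (List.mem_map.2 ⟨o, by simp, (congrArg Prod.fst hoi).symm⟩) hi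
  refine ⟨(i, !b) :: (j, e) :: q, ?_, List.Perm.refl _⟩
  exact List.isChain_cons_cons.2 ⟨by simpa [Follows, otherEnd] using hij, hc⟩

/-- In a chain cover with as few chains as possible no chain is a single path, because such a path
could be put in front of, or behind, the chain to which it is linked. -/
theorem exists_isChainCover_two_le_length [Finite I] (hσ : IsLinking H σ)
    (hH : ∀ {s s'}, H.Adj s s' → s.1 ≠ s'.1) :
    ∃ 𝓛, IsChainCover σ 𝓛 ∧ ∀ c ∈ 𝓛, 2 ≤ c.length := by
  classical
  obtain ⟨𝓛, h𝓛, hmin⟩ :=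
    exists_minimalFor_of_wellFoundedLT (IsChainCover σ) List.length (exists_isChainCover σ)
  refine ⟨𝓛, h𝓛, fun c hc => ?_⟩
  by_contra hlt
  obtain ⟨⟨i, b₀⟩, rfl⟩ : ∃ o, c = [o] := by
    have := List.length_pos_iff.2 (h𝓛.ne_nil c hc)
    exact List.length_eq_one_iff.1 (by omega)
  obtain ⟨b, ⟨j, d⟩, hbj⟩ := hσ.exists_eq_some i
  have hij : i ≠ j := hH (hσ.adj hbj)
  obtain ⟨c', hc', e, he⟩ := h𝓛.exists_mem j
  have hne : c' ≠ [(i, b₀)] := by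
    rintro rfl
    simp [hij.symm] at he
  have hperm : 𝓛.Perm ([[(i, b₀)], c'] ++ (𝓛.erase [(i, b₀)]).erase c') :=
    (List.perm_cons_erase hc).trans
      ((List.perm_cons_erase ((List.mem_erase_of_ne hne).2 hc')).cons _)
  have hi : i ∉ c'.map Prod.fst := by
    have hnodup := (h𝓛.isEnumeration.perm (hperm.flatten.map Prod.fst)).nodup
    simp only [List.cons_append, List.flatten_cons, List.map_append, List.map_cons,
      List.nil_append, List.nodup_cons, List.mem_append, not_or] at hnodup
    exact hnodup.1.1
  obtain ⟨m, hm, hmperm⟩ := hσ.exists_isChain_cons hbj (h𝓛.isChain c' hc') he hi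
  have hm_ne : m ≠ [] := by
    rintro rfl
    simp at hmperm
  have hle := hmin (h𝓛.replace hperm hm_ne hm (by simpa using hmperm))
  have hlen := hperm.length_eq
  simp only [List.length_append, List.length_cons, List.length_nil] at hle hlen
  omega

/-- If the number of chains is exactly half the number of paths, then every chain consists of two
paths, so the chain through `i₀` can be reversed to start with `i₀` if necessary. -/
theorem exists_isChainCover_head [Fintype I] (hσ : IsLinking H σ)
    (hH : ∀ {s s'}, H.Adj s s' → s.1 ≠ s'.1) (i₀ : I) :
    ∃ 𝓛, IsChainCover σ 𝓛 ∧ 2 * 𝓛.length ≤ Fintype.card I ∧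
      (2 * 𝓛.length = Fintype.card I → ∃ b c L, 𝓛 = ((i₀, b) :: c) :: L) := by
  classical
  obtain ⟨𝓛, h𝓛, htwo⟩ := hσ.exists_isChainCover_two_le_length hH
  have hle := two_mul_length_le_sum_length htwo
  rw [h𝓛.sum_length] at hle
  by_cases heq : 2 * 𝓛.length = Fintype.card I
  swap
  · exact ⟨𝓛, h𝓛, hle, fun h => absurd h heq⟩
  obtain ⟨c, hc, b, hb⟩ := h𝓛.exists_mem i₀
  have hperm := List.perm_cons_erase hc
  have hc2 : c.length = 2 := by
    have herase := two_mul_length_le_sum_length (L := 𝓛.erase c) fun d hd =>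
      htwo d (List.mem_of_mem_erase hd)
    have hsum := (hperm.map List.length).sum_eq
    have hlen := hperm.length_eq
    have := htwo c hc
    simp only [h𝓛.sum_length, List.map_cons, List.sum_cons, List.length_cons] at hsum hlen
    omega
  obtain ⟨o₁, o₂, rfl⟩ := List.length_eq_two.1 hc2
  have hlen := hperm.length_eq
  rw [List.length_cons] at hlen
  rcases (by simpa using hb : (i₀, b) = o₁ ∨ (i₀, b) = o₂) with rfl | rfl
  · have hcover : IsChainCover σ ([(i₀, b), o₂] :: 𝓛.erase [(i₀, b), o₂]) :=
      h𝓛.replace (L₁ := [[(i₀, b), o₂]]) hperm (by simp) (h𝓛.isChain _ hc) (by simp)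
    exact ⟨_, hcover, by simpa [← hlen] using hle, fun _ => ⟨b, _, _, rfl⟩⟩
  · have hcover : IsChainCover σ ([otherEnd (i₀, b), otherEnd o₁] :: 𝓛.erase [o₁, (i₀, b)]) :=
      h𝓛.replace (L₁ := [[o₁, (i₀, b)]]) hperm (by simp)
        (by simpa using hσ.isChain_reverse (h𝓛.isChain _ hc)) (by simpa using List.Perm.swap _ _ _)
    exact ⟨_, hcover, by simpa [← hlen] using hle, fun _ => ⟨!b, _, _, rfl⟩⟩

end IsLinking

end ChainCover

/-! ### Path partitions -/

section Breaks

variable {W : Type*} {G : SimpleGraph W}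

open Classical in
/-- The number of pairs of consecutive vertices of a list that are not adjacent in `G`. -/
noncomputable def breaks (G : SimpleGraph W) : List W → ℕ
  | [] => 0
  | [_] => 0
  | a :: b :: l => (if G.Adj a b then 0 else 1) + breaks G (b :: l)

lemma breaks_cons_le (G : SimpleGraph W) (a : W) (l : List W) :
    breaks G (a :: l) ≤ breaks G l + 1 := by
  rcases l with _ | ⟨b, l⟩
  · simp [breaks]
  · simp only [breaks]
    split_ifs <;> omega

lemma breaks_le_breaks_cons (G : SimpleGraph W) (a : W) (l : List W) :
    breaks G l ≤ breaks G (a :: l) := by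
  rcases l with _ | ⟨b, l⟩ <;> simp [breaks]

lemma breaks_append_le (G : SimpleGraph W) :
    ∀ l l' : List W, breaks G (l ++ l') ≤ breaks G l + breaks G l' + 1
  | [], l' => by simp only [List.nil_append, breaks]; omega
  | [a], l' => by simpa [breaks] using breaks_cons_le G a l'
  | a :: b :: l, l' => by
      have := breaks_append_le G (b :: l) l'
      simp only [List.cons_append, breaks] at this ⊢
      omega

lemma breaks_eq_zero : ∀ {l : List W}, l.IsChain G.Adj → breaks G l = 0
  | [], _ => rfl
  | [_], _ => rfl
  | a :: b :: l, h => by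
      rw [List.isChain_cons_cons] at h
      simp [breaks, h.1, breaks_eq_zero h.2]

lemma breaks_flatten_le : ∀ {L : List (List W)}, (∀ l ∈ L, l.IsChain G.Adj) →
    breaks G L.flatten ≤ L.length - 1
  | [], _ => by simp [breaks]
  | [l], h => by simpa using breaks_eq_zero (h l (by simp))
  | l :: l' :: L, h => by
      have hl := breaks_eq_zero (h l (by simp))
      have hL := breaks_flatten_le (L := l' :: L) fun c hc => h c (List.mem_cons_of_mem _ hc)
      have happend := breaks_append_le G l (l' :: L).flatten
      rw [List.flatten_cons]
      simp only [List.length_cons] at hL ⊢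
      omega

end Breaks

section PathPartition

variable {W I : Type*} {G : SimpleGraph W} {P : I → List W}

/-- A partition of the vertices of `G` into paths `P i`. -/
structure IsPathPartition (G : SimpleGraph W) (P : I → List W) : Prop where
  ne_nil : ∀ i, P i ≠ []
  isChain : ∀ i, (P i).IsChain G.Adj
  nodup : ∀ i, (P i).Nodup
  disjoint : ∀ {i j w}, w ∈ P i → w ∈ P j → i = j
  cover : ∀ w, ∃ i, w ∈ P i

/-- The path of which `s` is an end, traversed from that end: forwards for `(i, true)`, backwards
for `(i, false)`. -/
def orient (P : I → List W) (s : I × Bool) : List W :=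
  if s.2 then P s.1 else (P s.1).reverse

lemma mem_orient {s : I × Bool} {w : W} : w ∈ orient P s ↔ w ∈ P s.1 := by
  unfold orient
  split_ifs <;> simp

lemma orient_otherEnd (P : I → List W) (s : I × Bool) :
    orient P (otherEnd s) = (orient P s).reverse := by
  rcases s with ⟨i, _ | _⟩ <;> simp [orient, otherEnd]

namespace IsPathPartition

lemma orient_ne_nil (h : IsPathPartition G P) (s : I × Bool) : orient P s ≠ [] := by
  unfold orient
  split_ifs <;> simp [h.ne_nil]

lemma isChain_orient (h : IsPathPartition G P) (s : I × Bool) : (orient P s).IsChain G.Adj := by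
  unfold orient
  split_ifs
  · exact h.isChain _
  · exact List.isChain_reverse.2 ((h.isChain _).imp fun _ _ h => h.symm)

lemma nodup_orient (h : IsPathPartition G P) (s : I × Bool) : (orient P s).Nodup := by
  unfold orient
  split_ifs <;> simp [h.nodup]

/-- The vertex at the end `s` of a path of the partition. -/
def endVertex (h : IsPathPartition G P) (s : I × Bool) : W :=
  (orient P s).head (h.orient_ne_nil s)

lemma endVertex_mem (h : IsPathPartition G P) (s : I × Bool) : h.endVertex s ∈ P s.1 :=
  mem_orient.1 (List.head_mem _)

lemma head?_orient (h : IsPathPartition G P) (s : I × Bool) :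
    (orient P s).head? = some (h.endVertex s) := List.head?_eq_some_head _

lemma getLast?_orient (h : IsPathPartition G P) (s : I × Bool) :
    (orient P s).getLast? = some (h.endVertex (otherEnd s)) := by
  rw [← h.head?_orient, orient_otherEnd, List.head?_reverse]

/-- Adjacency between the ends of different paths of the partition. -/
def endGraph (h : IsPathPartition G P) : SimpleGraph (I × Bool) where
  Adj s s' := s.1 ≠ s'.1 ∧ G.Adj (h.endVertex s) (h.endVertex s')
  symm := ⟨fun _ _ h => ⟨h.1.symm, h.2.symm⟩⟩
  loopless := ⟨fun _ h => h.1 rfl⟩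

variable {σ : I × Bool → Option (I × Bool)}

lemma isChain_flatMap_orient (h : IsPathPartition G P) (hσ : IsLinking h.endGraph σ)
    {c : List (I × Bool)} (hc : c.IsChain (Follows σ)) :
    (c.flatMap (orient P)).IsChain G.Adj := by
  rw [List.flatMap_def, List.isChain_flatten fun hnil => ?_, List.isChain_map]
  swap
  · obtain ⟨s, -, hs⟩ := List.mem_map.1 hnil
    exact h.orient_ne_nil s hs
  refine ⟨List.forall_mem_map.2 fun s _ => h.isChain_orient s, hc.imp fun o o' ho => ?_⟩
  simpa [h.getLast?_orient, h.head?_orient] using (hσ.adj ho).2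

lemma isEnumeration_flatMap_orient (h : IsPathPartition G P) {L : List (I × Bool)}
    (hL : IsEnumeration (L.map Prod.fst)) : IsEnumeration (L.flatMap (orient P)) := by
  refine ⟨List.nodup_flatMap.2 ⟨fun s _ => h.nodup_orient s, ?_⟩, fun w => ?_⟩
  · exact (List.pairwise_map.1 hL.nodup).imp fun hne w hw hw' =>
      hne (h.disjoint (mem_orient.1 hw) (mem_orient.1 hw'))
  · obtain ⟨i, hi⟩ := h.cover w
    obtain ⟨s, hs, rfl⟩ := List.mem_map.1 (hL.mem i)
    exact List.mem_flatMap.2 ⟨s, hs, mem_orient.2 hi⟩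

/-- `k` is the number of chains of a chain cover, along which the paths are concatenated. -/
theorem exists_isEnumeration_breaks [Fintype I] (h : IsPathPartition G P)
    (hlink : LinkingCondition h.endGraph) (i₀ : I) :
    ∃ (k : ℕ) (l : List W), IsEnumeration l ∧ breaks G l + 1 ≤ k ∧ 2 * k ≤ Fintype.card I ∧
      (2 * k = Fintype.card I → ∃ b l', l = orient P (i₀, b) ++ l') := by
  obtain ⟨σ, hσ⟩ := hlink.exists_isLinking
  obtain ⟨𝓛, h𝓛, hle, hhead⟩ := hσ.exists_isChainCover_head (fun hadj => hadj.1) i₀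
  refine ⟨𝓛.length, 𝓛.flatten.flatMap (orient P), h.isEnumeration_flatMap_orient h𝓛.isEnumeration,
    ?_, hle, fun heq => ?_⟩
  · have hpos : 𝓛 ≠ [] := by
      rintro rfl
      simpa using h𝓛.isEnumeration.mem i₀
    have hbreaks := breaks_flatten_le (G := G) (L := 𝓛.map fun c => c.flatMap (orient P)) (by
      simpa using fun c hc => h.isChain_flatMap_orient hσ (h𝓛.isChain c hc))
    have hflatten :
        𝓛.flatten.flatMap (orient P) = (𝓛.map fun c => c.flatMap (orient P)).flatten := by
      simp [List.flatMap_def, List.map_flatten, List.flatten_flatten, Function.comp_def]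
    have := List.length_pos_iff.2 hpos
    rw [hflatten]
    rw [List.length_map] at hbreaks
    omega
  · obtain ⟨b, c, L, rfl⟩ := hhead heq
    exact ⟨b, (c ++ L.flatten).flatMap (orient P), by simp⟩

end IsPathPartition

end PathPartition

section AddUniversal

variable {V : Type*} {G : SimpleGraph V} {T : ℕ}

/-- The graph `G` with `T` further vertices, each adjacent to all other vertices. -/
def addUniversal (G : SimpleGraph V) (T : ℕ) : SimpleGraph (V ⊕ Fin T) where
  Adj x y := x ≠ y ∧ ∀ u v, x = .inl u → y = .inl v → G.Adj u v
  symm := ⟨fun _ _ h => ⟨h.1.symm, fun u v hu hv => (h.2 v u hv hu).symm⟩⟩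
  loopless := ⟨fun _ h => h.1 rfl⟩

@[simp] lemma addUniversal_adj_inl {u v : V} :
    (addUniversal G T).Adj (.inl u) (.inl v) ↔ G.Adj u v :=
  ⟨fun h => h.2 u v rfl rfl, fun h => ⟨by simpa using h.ne, by rintro _ _ ⟨⟩ ⟨⟩; exact h⟩⟩

lemma addUniversal_adj_inr {x : V ⊕ Fin T} {d : Fin T} :
    (addUniversal G T).Adj x (.inr d) ↔ x ≠ .inr d :=
  ⟨fun h => h.1, fun h => ⟨h, by simp⟩⟩

lemma IsEnumeration.filterMap_getLeft? {l : List (V ⊕ Fin T)} (h : IsEnumeration l) :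
    IsEnumeration (l.filterMap Sum.getLeft?) :=
  ⟨h.nodup.filterMap (by simp), fun v => List.mem_filterMap.2 ⟨.inl v, h.mem _, rfl⟩⟩

lemma IsEnumeration.countP_isRight {l : List (V ⊕ Fin T)} (h : IsEnumeration l) :
    l.countP Sum.isRight = T := by
  have hright : IsEnumeration (l.filterMap Sum.getRight?) :=
    ⟨h.nodup.filterMap (by simp), fun d => List.mem_filterMap.2 ⟨.inr d, h.mem _, rfl⟩⟩
  calc l.countP Sum.isRight = l.countP fun x => x.getRight?.isSome :=
        List.countP_congr fun _ _ => Sum.isSome_getRight?_iff_isRight.symm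
    _ = T := by rw [← List.length_filterMap_eq_countP, hright.length_eq, Fintype.card_fin]

lemma breaks_filterMap_getLeft?_le : ∀ l : List (V ⊕ Fin T),
    breaks G (l.filterMap Sum.getLeft?) ≤ breaks (addUniversal G T) l + l.countP Sum.isRight
  | [] => by simp [breaks]
  | .inr d :: l => by
      have hl := breaks_filterMap_getLeft?_le l
      have hcons := breaks_le_breaks_cons (addUniversal G T) (.inr d) l
      simp only [List.filterMap_cons, Sum.getLeft?_inr, List.countP_cons, Sum.isRight_inr, if_true]
      omega
  | [.inl u] => by simp [breaks]
  | .inl u :: .inl v :: l => by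
      have hl := breaks_filterMap_getLeft?_le (.inl v :: l)
      simp only [List.filterMap_cons, Sum.getLeft?_inl, List.countP_cons, Sum.isRight_inl,
        Bool.false_eq_true, if_false, add_zero, breaks] at hl ⊢
      by_cases huv : G.Adj u v
      · rw [if_pos huv, if_pos (addUniversal_adj_inl.2 huv)]
        omega
      · rw [if_neg huv, if_neg (addUniversal_adj_inl.not.2 huv)]
        omega
  | .inl u :: .inr d :: l => by
      have hl := breaks_filterMap_getLeft?_le l
      have hcons := breaks_le_breaks_cons (addUniversal G T) (.inr d) l
      have hu := breaks_cons_le G u (l.filterMap Sum.getLeft?)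
      simp only [List.filterMap_cons, Sum.getLeft?_inl, Sum.getLeft?_inr, List.countP_cons,
        Sum.isRight_inl, Sum.isRight_inr, if_true, Bool.false_eq_true, if_false, breaks,
        addUniversal_adj_inr, ne_eq, reduceCtorEq, not_false_eq_true]
      omega

lemma IsEnumeration.breaks_filterMap_getLeft?_le {l : List (V ⊕ Fin T)} (h : IsEnumeration l) :
    breaks G (l.filterMap Sum.getLeft?) ≤ breaks (addUniversal G T) l + T := by
  simpa [h.countP_isRight] using OneTwoTSP.breaks_filterMap_getLeft?_le (G := G) l

lemma IsEnumeration.breaks_filterMap_getLeft?_cons_lt {d : Fin T} {l : List (V ⊕ Fin T)}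
    (h : IsEnumeration (.inr d :: l)) :
    breaks G (l.filterMap Sum.getLeft?) < breaks (addUniversal G T) (.inr d :: l) + T := by
  have hcount := h.countP_isRight
  have hl := OneTwoTSP.breaks_filterMap_getLeft?_le (G := G) l
  have hcons := breaks_le_breaks_cons (addUniversal G T) (.inr d) l
  simp only [List.countP_cons, Sum.isRight_inr, if_true] at hcount
  omega

end AddUniversal

section MatchingPartition

variable {W : Type*} {G : SimpleGraph W}

lemma isPathPartition_get {L : List (List W)} (hne : ∀ l ∈ L, l ≠ [])
    (hchain : ∀ l ∈ L, l.IsChain G.Adj) (h : IsEnumeration L.flatten) :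
    IsPathPartition G L.get where
  ne_nil i := hne _ (L.get_mem i)
  isChain i := hchain _ (L.get_mem i)
  nodup i := (List.nodup_flatten.1 h.nodup).1 _ (L.get_mem i)
  disjoint {i j w} hi hj := by
    have hpair := List.pairwise_iff_getElem.1 (List.nodup_flatten.1 h.nodup).2
    by_contra hij
    rcases Fin.lt_or_lt_of_ne hij with hlt | hlt
    · exact hpair _ _ i.2 j.2 hlt hi hj
    · exact hpair _ _ j.2 i.2 hlt hj hi
  cover w := by
    obtain ⟨l, hl, hw⟩ := List.mem_flatten.1 (h.mem w)
    obtain ⟨i, rfl⟩ := List.get_of_mem hl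
    exact ⟨i, hw⟩

lemma exists_list_pairs {σ : W → W} (S : Finset W)
    (hσ : ∀ u ∈ S, σ u ∈ S ∧ σ u ≠ u ∧ σ (σ u) = u) :
    ∃ L : List (List W), L.flatten.Nodup ∧ (∀ u, u ∈ L.flatten ↔ u ∈ S) ∧
      2 * L.length = S.card ∧ ∀ l ∈ L, ∃ u ∈ S, l = [u, σ u] := by
  classical
  induction S using Finset.strongInduction with
  | H S ih =>
    rcases S.eq_empty_or_nonempty with rfl | ⟨u, hu⟩
    · exact ⟨[], by simp⟩
    obtain ⟨huS, hne, hσσ⟩ := hσ u hu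
    set S' := (S.erase u).erase (σ u) with hS'
    have hσuS : σ u ∈ S.erase u := Finset.mem_erase.2 ⟨hne, huS⟩
    obtain ⟨L, hnodup, hmem, hlen, hpairs⟩ := ih S'
      ((Finset.erase_ssubset hσuS).trans (Finset.erase_ssubset hu)) fun v hv => by
        obtain ⟨hvσ, hvu, hv⟩ : v ≠ σ u ∧ v ≠ u ∧ v ∈ S := by simpa [hS'] using hv
        obtain ⟨hvS, hvne, hvv⟩ := hσ v hv
        refine ⟨?_, hvne, hvv⟩
        simp only [hS', Finset.mem_erase]
        exact ⟨fun h => hvu (by rw [← hvv, h, hσσ]), fun h => hvσ (by rw [← h, hvv]), hvS⟩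
    refine ⟨[u, σ u] :: L, ?_, fun v => ?_, ?_, ?_⟩
    · simp [hnodup, hmem, hS', hne.symm]
    · simp only [List.flatten_cons, List.mem_append, hmem, hS', Finset.mem_erase, List.mem_cons,
        List.not_mem_nil, or_false]
      grind
    · rw [hS', Finset.card_erase_of_mem hσuS, Finset.card_erase_of_mem hu] at hlen
      have := Finset.card_pos.2 ⟨u, hu⟩
      have := Finset.card_pos.2 ⟨_, hσuS⟩
      rw [Finset.card_erase_of_mem hu] at this
      rw [List.length_cons]
      omega
    · rintro l (_ | ⟨_, hl⟩)
      · exact ⟨u, hu, rfl⟩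
      · obtain ⟨v, hv, rfl⟩ := hpairs l hl
        exact ⟨v, Finset.mem_of_mem_erase (Finset.mem_of_mem_erase hv), rfl⟩

lemma IsMatchingOff.exists_isPathPartition [Fintype W] {Q : List (List W)} {σ : W → W}
    (hσ : IsMatchingOff G {u | u ∈ Q.flatten} σ) (hne : ∀ q ∈ Q, q ≠ [])
    (hchain : ∀ q ∈ Q, q.IsChain G.Adj) (hnodup : Q.flatten.Nodup) :
    ∃ (m : ℕ) (P : Fin m → List W), IsPathPartition G P ∧
      2 * m + Q.flatten.length = Fintype.card W + 2 * Q.length ∧ (∀ q ∈ Q, ∃ i, P i = q) ∧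
      ∀ u, u ∉ Q.flatten → ∃ i y, P i = [u, y] ∨ P i = [y, u] := by
  classical
  obtain ⟨L, hLnodup, hLmem, hLlen, hLpairs⟩ := exists_list_pairs (σ := σ) Q.flatten.toFinsetᶜ
    fun u hu => by
      obtain ⟨hmem, hadj, hinv⟩ := hσ u (by simpa using hu)
      exact ⟨by simpa using hmem, hadj.ne', hinv⟩
  simp only [Finset.mem_compl, List.mem_toFinset] at hLmem hLpairs
  refine ⟨(L ++ Q).length, (L ++ Q).get, isPathPartition_get (fun l hl => ?_) (fun l hl => ?_)
    ⟨?_, fun w => ?_⟩, ?_, fun q hq => List.get_of_mem (List.mem_append_right L hq), fun u hu => ?_⟩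
  · rcases List.mem_append.1 hl with hl | hl
    · obtain ⟨u, -, rfl⟩ := hLpairs l hl
      simp
    · exact hne l hl
  · rcases List.mem_append.1 hl with hl | hl
    · obtain ⟨u, hu, rfl⟩ := hLpairs l hl
      simpa using (hσ u hu).2.1
    · exact hchain l hl
  · rw [List.flatten_append]
    exact hLnodup.append hnodup fun u hu => (hLmem u).1 hu
  · rw [List.flatten_append, List.mem_append, hLmem]
    exact (em _).symm
  · rw [Finset.card_compl, List.toFinset_card_of_nodup hnodup] at hLlen
    have hle := hnodup.length_le_card
    rw [List.length_append]
    omega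
  · obtain ⟨l, hl, hul⟩ := List.mem_flatten.1 ((hLmem u).2 hu)
    obtain ⟨i, hi⟩ := List.get_of_mem (List.mem_append_left Q hl)
    obtain ⟨v, -, rfl⟩ := hLpairs l hl
    rcases List.mem_pair.1 hul with rfl | rfl
    exacts [⟨i, _, .inl hi⟩, ⟨i, _, .inr hi⟩]

end MatchingPartition

/-! ### Fractional tours -/

/-- A fractional tour: symmetric edge weights `w` with the degree, cut and bound constraints of the
subtour LP, the cut constraints being imposed for every nonempty proper subset. -/
structure IsFracTour {V : Type*} [Fintype V] [DecidableEq V] (w : V → V → ℝ) : Prop where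
  symm : ∀ u v, w u v = w v u
  nonneg : ∀ u v, 0 ≤ w u v
  le_one : ∀ u v, w u v ≤ 1
  self : ∀ u, w u u = 0
  degree : ∀ u, ∑ v, w u v = 2
  cut : ∀ S : Finset V, S.Nonempty → S ≠ Finset.univ → 2 ≤ ∑ u ∈ S, ∑ v ∈ Sᶜ, w u v

section WeightOff

variable {V : Type*} [Fintype V]

open Classical in
/-- The total weight of the pairs `(u, v)` that are not related by `K`. -/
noncomputable def weightOff (w : V → V → ℝ) (K : V → V → Prop) (u : V) : ℝ :=
  ∑ v with ¬ K u v, w u v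

/-- The total weight of the unordered pairs that are not edges of `G`. -/
noncomputable def nonEdgeWeight (G : SimpleGraph V) (w : V → V → ℝ) : ℝ :=
  (∑ u, weightOff w G.Adj u) / 2

end WeightOff

namespace IsFracTour

variable {V : Type*} [Fintype V] [DecidableEq V] {w : V → V → ℝ}

lemma weightOff_nonneg (hw : IsFracTour w) (K : V → V → Prop) (u : V) : 0 ≤ weightOff w K u :=
  Finset.sum_nonneg fun v _ => hw.nonneg u v

lemma nonEdgeWeight_nonneg (hw : IsFracTour w) (G : SimpleGraph V) : 0 ≤ nonEdgeWeight G w :=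
  div_nonneg (Finset.sum_nonneg fun u _ => hw.weightOff_nonneg _ u) two_pos.le

lemma weightOff_le (hw : IsFracTour w) (G : SimpleGraph V) {K : V → V → Prop} {J Q : Finset V}
    {u : V} (h : ∀ v, G.Adj u v → v ∉ J → v ∉ Q → K u v) [DecidablePred (K u)] :
    weightOff w K u ≤ weightOff w G.Adj u + ∑ v ∈ J, w u v + ∑ v ∈ Q with ¬ K u v, w u v := by
  classical
  have hle : ∀ s t : Finset V, ∑ v ∈ s ∪ t, w u v ≤ ∑ v ∈ s, w u v + ∑ v ∈ t, w u v := fun s t => by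
    rw [← Finset.sum_union_inter]
    exact le_add_of_nonneg_right (Finset.sum_nonneg fun v _ => hw.nonneg u v)
  refine le_trans ?_ ((hle _ _).trans (add_le_add_left (hle _ _) _))
  refine Finset.sum_le_sum_of_subset_of_nonneg (fun v hv => ?_) fun v _ _ => hw.nonneg u v
  simp only [Finset.mem_union, Finset.mem_filter, Finset.mem_univ, true_and] at hv ⊢
  grind

/-- A pair leaving `B` that is not related by `K` is a non-edge or meets `J` or `Q`. -/
lemma sum_weightOff_le (hw : IsFracTour w) (G : SimpleGraph V) {K : V → V → Prop}
    (hK : ∀ u v, K u v → K v u) {B J Q : Finset V}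
    (h : ∀ u ∈ B, ∀ v, G.Adj u v → v ∉ J → v ∉ Q → K u v) :
    ∑ u ∈ B, weightOff w K u ≤ 2 * nonEdgeWeight G w + 2 * J.card + ∑ u ∈ Q, weightOff w K u := by
  classical
  have hJ : ∑ u, ∑ v ∈ J, w u v = 2 * J.card := by
    rw [Finset.sum_comm]
    simp_rw [fun u v => hw.symm u v, hw.degree]
    rw [Finset.sum_const, nsmul_eq_mul, mul_comm]
  have hQ : ∑ u, ∑ v ∈ Q with ¬ K u v, w u v = ∑ u ∈ Q, weightOff w K u := by
    simp_rw [weightOff]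
    rw [Finset.sum_comm' (t' := Q) (s' := fun v => Finset.univ.filter fun u => ¬ K v u)]
    · exact Finset.sum_congr rfl fun v _ => Finset.sum_congr rfl fun u _ => hw.symm u v
    · intro u v
      simp only [Finset.mem_filter, Finset.mem_univ, true_and]
      exact ⟨fun ⟨hv, hK'⟩ => ⟨fun hvu => hK' (hK _ _ hvu), hv⟩,
        fun ⟨hK', hv⟩ => ⟨hv, fun huv => hK' (hK _ _ huv)⟩⟩
  calc ∑ u ∈ B, weightOff w K u
      ≤ ∑ u ∈ B, (weightOff w G.Adj u + ∑ v ∈ J, w u v + ∑ v ∈ Q with ¬ K u v, w u v) :=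
        Finset.sum_le_sum fun u hu => hw.weightOff_le G (h u hu)
    _ ≤ ∑ u, (weightOff w G.Adj u + ∑ v ∈ J, w u v + ∑ v ∈ Q with ¬ K u v, w u v) := by
        refine Finset.sum_le_univ_sum_of_nonneg fun u => ?_
        have hs : ∀ s : Finset V, 0 ≤ ∑ v ∈ s, w u v :=
          fun s => Finset.sum_nonneg fun v _ => hw.nonneg u v
        exact add_nonneg (add_nonneg (hs _) (hs _)) (hs _)
    _ = 2 * nonEdgeWeight G w + 2 * J.card + ∑ u ∈ Q, weightOff w K u := by
        rw [Finset.sum_add_distrib, Finset.sum_add_distrib, hJ, hQ, nonEdgeWeight]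
        ring

variable {G : SimpleGraph V} {T : ℕ}

lemma card_image_labels_le (hw : IsFracTour w) {κ : Type*} [DecidableEq κ] {J : Finset V}
    {f : V → κ} (hf : IsComponentLabelling G J f) (hone : 1 < (Jᶜ.image f).card) :
    ((Jᶜ.image f).card : ℝ) ≤ nonEdgeWeight G w + J.card := by
  classical
  let K : V → V → Prop := fun u v => u ∉ J ∧ v ∉ J ∧ f u = f v
  have hfibre : ∀ ℓ ∈ Jᶜ.image f, 2 ≤ ∑ u ∈ Jᶜ with f u = ℓ, weightOff w K u := by
    intro ℓ hℓ
    obtain ⟨ℓ', hℓ', hne⟩ := Finset.exists_mem_ne hone ℓ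
    obtain ⟨u, hu, rfl⟩ := Finset.mem_image.1 hℓ
    obtain ⟨v, -, rfl⟩ := Finset.mem_image.1 hℓ'
    refine (hw.cut {x ∈ Jᶜ | f x = f u} ⟨u, Finset.mem_filter.2 ⟨hu, rfl⟩⟩ fun h => hne ?_).trans
      (Finset.sum_le_sum fun x hx => ?_)
    · have hvu : v ∈ Finset.filter (f · = f u) Jᶜ := h ▸ Finset.mem_univ v
      exact (Finset.mem_filter.1 hvu).2
    · refine (Finset.sum_congr (Finset.ext fun y => ?_) fun _ _ => rfl).le
      obtain ⟨hxJ, hxu⟩ : x ∉ J ∧ f x = f u := by simpa using hx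
      simp [K, hxJ, hxu, eq_comm]
  have hsum := hw.sum_weightOff_le G (K := K) (fun u v ⟨hu, hv, huv⟩ => ⟨hv, hu, huv.symm⟩)
    (B := Jᶜ) (J := J) (Q := ∅) fun u hu v huv hv _ =>
      ⟨Finset.mem_compl.1 hu, hv, hf (Finset.mem_compl.1 hu) hv huv⟩
  rw [← Finset.sum_fiberwise_of_maps_to fun u hu => Finset.mem_image_of_mem f hu] at hsum
  have hcard := Finset.card_nsmul_le_sum _ _ _ hfibre
  rw [Finset.sum_empty, add_zero] at hsum
  rw [nsmul_eq_mul] at hcard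
  linarith

theorem isOneTough_addUniversal (hw : IsFracTour w) (hT : nonEdgeWeight G w < T + 1) :
    IsOneTough (addUniversal G T) := by
  intro S f hf
  by_cases hall : ∀ d, .inr d ∈ S
  swap
  · push Not at hall
    obtain ⟨d, hd⟩ := hall
    refine le_max_of_le_left ((Finset.card_le_card fun ℓ hℓ => ?_).trans
      (Finset.card_singleton (f (.inr d))).le)
    obtain ⟨x, hx, rfl⟩ := Finset.mem_image.1 hℓ
    rw [Finset.mem_singleton]
    rcases eq_or_ne x (.inr d) with rfl | hne
    · rfl
    · exact hf (Finset.mem_compl.1 hx) hd (addUniversal_adj_inr.2 hne)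
  have himage : Sᶜ.image f = S.toLeftᶜ.image (f ∘ Sum.inl) := by
    ext ℓ
    simp [hall]
  have hlabel : IsComponentLabelling G S.toLeft (f ∘ Sum.inl) := fun u v hu hv huv =>
    hf (by simpa using hu) (by simpa using hv) (addUniversal_adj_inl.2 huv)
  have hright : S.toRight.card = T := by
    rw [(Finset.eq_univ_iff_forall (s := S.toRight)).2 (by simpa using hall), Finset.card_univ,
      Fintype.card_fin]
  have hS := S.card_toLeft_add_card_toRight
  rw [himage]
  by_cases hone : 1 < (S.toLeftᶜ.image (f ∘ Sum.inl)).card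
  · have hlt : ((S.toLeftᶜ.image (f ∘ Sum.inl)).card : ℝ) < (T + S.toLeft.card + 1 : ℕ) := by
      push_cast
      linarith [hw.card_image_labels_le hlabel hone]
    have := Nat.cast_lt.1 hlt
    omega
  · omega

end IsFracTour

/-! ### The linking condition for fractional tours -/

namespace IsPathPartition

variable {W I : Type*} {G : SimpleGraph W} {P : I → List W}

lemma fst_eq_of_endVertex_mem (h : IsPathPartition G P) {s : I × Bool} {i : I}
    (hs : h.endVertex s ∈ P i) : s.1 = i :=
  h.disjoint (h.endVertex_mem s) hs

lemma endVertex_true_of_eq_cons (h : IsPathPartition G P) {x : W} {i : I} {l : List W}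
    (hi : P i = x :: l) : h.endVertex (i, true) = x := by
  simpa [orient, hi] using (h.head?_orient (i, true)).symm

lemma endVertex_false_of_eq_append (h : IsPathPartition G P) {x : W} {i : I} {l : List W}
    (hi : P i = l ++ [x]) : h.endVertex (i, false) = x := by
  simpa [orient, hi] using (h.head?_orient (i, false)).symm

lemma exists_endVertex_of_pair (h : IsPathPartition G P) {x y : W} {i : I}
    (hi : P i = [x, y] ∨ P i = [y, x]) : ∃ s, h.endVertex s = x := by
  rcases hi with hi | hi
  exacts [⟨_, h.endVertex_true_of_eq_cons hi⟩, ⟨_, h.endVertex_false_of_eq_append (l := [y]) hi⟩]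

lemma not_exists_endVertex_of_triple (h : IsPathPartition G P) {x y z : W} {i : I}
    (hi : P i = [x, y, z]) : ¬ ∃ s, h.endVertex s = y := by
  have hnodup := h.nodup i
  simp only [hi, List.nodup_cons, List.mem_cons, List.not_mem_nil, or_false, not_or] at hnodup
  obtain ⟨⟨hxy, -⟩, hyz, -⟩ := hnodup
  rintro ⟨⟨j, b⟩, hs⟩
  obtain rfl : j = i := h.fst_eq_of_endVertex_mem (s := (j, b)) (by simp [hs, hi])
  cases b
  · exact hyz (hs.symm.trans (h.endVertex_false_of_eq_append (l := [x, y]) hi))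
  · exact hxy ((h.endVertex_true_of_eq_cons hi).symm.trans hs)

lemma ncard_endVertex_le_two (h : IsPathPartition G P) (x : W) :
    {s | h.endVertex s = x}.ncard ≤ 2 := by
  obtain ⟨i, hi⟩ := h.cover x
  have hsub : {s | h.endVertex s = x} ⊆ {(i, true), (i, false)} := by
    rintro ⟨j, b⟩ rfl
    obtain rfl := h.fst_eq_of_endVertex_mem hi
    cases b <;> simp
  exact (Set.ncard_le_ncard hsub (Set.toFinite _)).trans (Set.ncard_pair (by simp)).le

lemma endVertex_true_ne_endVertex_false (h : IsPathPartition G P) {i : I}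
    (hlen : 2 ≤ (P i).length) : h.endVertex (i, true) ≠ h.endVertex (i, false) := by
  simp only [endVertex, orient, if_true, Bool.false_eq_true, if_false, List.head_reverse]
  rw [List.head_eq_getElem, List.getLast_eq_getElem, ne_eq, (h.nodup i).getElem_inj_iff]
  omega

lemma ncard_endVertex_le_one [Finite I] (h : IsPathPartition G P) {x : W} {i : I} (hi : x ∈ P i)
    (hlen : 2 ≤ (P i).length) : {s | h.endVertex s = x}.ncard ≤ 1 := by
  rw [Set.ncard_le_one_iff_subsingleton]
  rintro ⟨j, b⟩ hs ⟨j', b'⟩ hs'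
  rw [Set.mem_ofPred_eq] at hs hs'
  obtain rfl : j = i := h.fst_eq_of_endVertex_mem (hs ▸ hi)
  obtain rfl : j' = j := h.fst_eq_of_endVertex_mem (hs' ▸ hi)
  have hne := h.endVertex_true_ne_endVertex_false hlen
  cases b <;> cases b' <;> simp_all

end IsPathPartition

section SamePath

variable {V I : Type*} {T : ℕ} {P : I → List (V ⊕ Fin T)} {G : SimpleGraph V}

/-- `u` and `v` lie on a common path of `P`. -/
def SamePath (P : I → List (V ⊕ Fin T)) (u v : V) : Prop := ∃ i, .inl u ∈ P i ∧ .inl v ∈ P i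

lemma SamePath.symm {u v : V} (h : SamePath P u v) : SamePath P v u :=
  let ⟨i, hu, hv⟩ := h; ⟨i, hv, hu⟩

variable [Fintype V] [DecidableEq V] {w : V → V → ℝ}

lemma IsFracTour.weightOff_samePath (hw : IsFracTour w)
    (h : IsPathPartition (addUniversal G T) P) {u : V} {i : I} (hu : .inl u ∈ P i) {F : Finset V}
    (hF : ∀ v, v ∈ F ↔ .inl v ∈ P i) :
    weightOff w (SamePath P) u = 2 - ∑ v ∈ F, w u v := by
  classical
  have hiff : ∀ v, SamePath P u v ↔ v ∈ F := fun v => by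
    rw [hF]
    exact ⟨fun ⟨j, hj, hv⟩ => h.disjoint hj hu ▸ hv, fun hv => ⟨i, hu, hv⟩⟩
  rw [← hw.degree u, eq_sub_iff_add_eq, weightOff]
  simp only [hiff]
  rw [add_comm, ← Finset.sum_add_sum_compl F]
  congr 2
  ext v
  simp

lemma IsFracTour.one_le_weightOff_of_pair (hw : IsFracTour w)
    (h : IsPathPartition (addUniversal G T) P) {u : V} {y : V ⊕ Fin T} {i : I}
    (hi : P i = [.inl u, y] ∨ P i = [y, .inl u]) : 1 ≤ weightOff w (SamePath P) u := by
  have hmem : ∀ x, x ∈ P i ↔ x = .inl u ∨ x = y := fun x => by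
    rcases hi with hi | hi <;> simp [hi, or_comm]
  rcases y with v | d
  · rw [hw.weightOff_samePath h ((hmem _).2 (.inl rfl)) (F := {u, v}) (by simp [hmem])]
    have hnodup := h.nodup i
    have huv : u ≠ v := by rcases hi with hi | hi <;> simp_all [eq_comm]
    rw [Finset.sum_pair huv, hw.self]
    linarith [hw.le_one u v]
  · rw [hw.weightOff_samePath h ((hmem _).2 (.inl rfl)) (F := {u}) (by simp [hmem]),
      Finset.sum_singleton, hw.self]
    norm_num

end SamePath

namespace IsPathPartition

variable {V I : Type*} {G : SimpleGraph V} {T : ℕ} {P : I → List (V ⊕ Fin T)}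

lemma endGraph_adj_or_samePath (h : IsPathPartition (addUniversal G T) P) {a s : I × Bool} {u v : V}
    (ha : h.endVertex a = .inl u) (hs : h.endVertex s = .inl v) (huv : G.Adj u v) :
    h.endGraph.Adj a s ∨ SamePath P u v := by
  by_cases has : a.1 = s.1
  · exact .inr ⟨a.1, ha ▸ h.endVertex_mem a, has ▸ hs ▸ h.endVertex_mem s⟩
  · refine .inl ⟨has, ?_⟩
    rw [ha, hs]
    exact addUniversal_adj_inl.2 huv

/-- An end in `A` that is a universal vertex is joined to all ends of the other paths. -/
lemma card_le_two_mul_ncard_of_universal [Fintype I] (h : IsPathPartition (addUniversal G T) P)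
    (hI : 2 ≤ Fintype.card I) {A : Finset (I × Bool)} {a : I × Bool} (ha : a ∈ A) {d : Fin T}
    (hd : h.endVertex a = .inr d) :
    A.card ≤ 2 * {s | ∃ a ∈ A, h.endGraph.Adj a s}.ncard + 1 := by
  classical
  have hsub : ↑(Finset.univ.erase a.1 ×ˢ (Finset.univ : Finset Bool)) ⊆
      {s | ∃ a ∈ A, h.endGraph.Adj a s} := by
    intro s hs
    have hne : s.1 ≠ a.1 := by simpa using hs
    refine ⟨a, ha, hne.symm, ?_⟩
    rw [hd]
    refine (addUniversal_adj_inr.2 fun hs => hne ?_).symm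
    exact h.fst_eq_of_endVertex_mem (hs.trans hd.symm ▸ h.endVertex_mem a)
  have hcard := Set.ncard_le_ncard hsub (Set.toFinite _)
  have hA := A.card_le_univ
  simp only [Fintype.card_prod, Fintype.card_bool] at hA
  rw [Set.ncard_coe_finset, Finset.card_product,
    Finset.card_erase_of_mem (Finset.mem_univ _)] at hcard
  simp only [Finset.card_univ, Fintype.card_bool] at hcard
  omega

lemma card_add_le_ncard [Finite I] (h : IsPathPartition (addUniversal G T) P)
    {A : Finset (I × Bool)} (hA : 1 < A.card) (hAinl : ∀ a ∈ A, ∀ d, h.endVertex a ≠ .inr d)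
    (hend : ∀ d, ∃ s, h.endVertex s = .inr d) {J : Finset V}
    (hJ : ∀ v ∈ J, ∃ s, (∃ a ∈ A, h.endGraph.Adj a s) ∧ h.endVertex s = .inl v) :
    J.card + T ≤ {s | ∃ a ∈ A, h.endGraph.Adj a s}.ncard := by
  classical
  have hdisj : ↑(J.disjSum (Finset.univ : Finset (Fin T))) ⊆
      h.endVertex '' {s | ∃ a ∈ A, h.endGraph.Adj a s} := by
    rintro (v | d) hx
    · exact hJ v (by simpa using hx)
    obtain ⟨s, hs⟩ := hend d
    obtain ⟨a, ha, hne⟩ : ∃ a ∈ A, a.1 ≠ s.1 := by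
      by_contra! hall
      have hsub : A ⊆ {s, otherEnd s} := fun ⟨i, b⟩ ha => by
        obtain rfl : i = s.1 := hall _ ha
        rcases s with ⟨i, b'⟩
        cases b <;> cases b' <;> simp [otherEnd]
      have hsA : s ∈ A := by
        rw [Finset.eq_of_subset_of_card_le hsub (Finset.card_le_two.trans hA)]
        simp
      exact hAinl s hsA d hs
    refine ⟨s, ⟨a, ha, hne, ?_⟩, hs⟩
    rw [hs]
    exact addUniversal_adj_inr.2 (hAinl a ha d)
  have hcard := (Set.ncard_le_ncard hdisj (Set.toFinite _)).trans
    (Set.ncard_image_le (Set.toFinite _))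
  rwa [Set.ncard_coe_finset, Finset.card_disjSum, Finset.card_univ, Fintype.card_fin] at hcard

lemma card_le_sum_ncard [Finite I] (h : IsPathPartition (addUniversal G T) P)
    {A : Finset (I × Bool)} {B : Finset V} (hB : ∀ a ∈ A, ∃ u ∈ B, h.endVertex a = .inl u) :
    A.card ≤ ∑ u ∈ B, {s | h.endVertex s = .inl u}.ncard := by
  classical
  have := Fintype.ofFinite I
  have hsub : A ⊆ B.biUnion fun u => Finset.univ.filter fun s => h.endVertex s = .inl u :=
    fun a ha => by simpa using hB a ha
  refine ((Finset.card_le_card hsub).trans Finset.card_biUnion_le).trans_eq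
    (Finset.sum_congr rfl fun u _ => ?_)
  rw [← Set.ncard_coe_finset]
  simp

end IsPathPartition

namespace IsFracTour

variable {V I : Type*} [Fintype V] [DecidableEq V] {G : SimpleGraph V} {w : V → V → ℝ} {T : ℕ}
  {P : I → List (V ⊕ Fin T)}

lemma sum_weightOff_samePath_le (hw : IsFracTour w) (h : IsPathPartition (addUniversal G T) P)
    {A : Finset (I × Bool)} {B J Q : Finset V} (hB : ∀ u ∈ B, ∃ a ∈ A, h.endVertex a = .inl u)
    (hJ : ∀ v, (∃ s, (∃ a ∈ A, h.endGraph.Adj a s) ∧ h.endVertex s = .inl v) → v ∈ J)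
    (hQ : ∀ v, (¬ ∃ s, h.endVertex s = .inl v) → v ∈ Q) :
    ∑ u ∈ B, weightOff w (SamePath P) u ≤
      2 * nonEdgeWeight G w + 2 * J.card + ∑ u ∈ Q, weightOff w (SamePath P) u := by
  refine hw.sum_weightOff_le G (fun _ _ => SamePath.symm) fun u hu v huv hvJ hvQ => ?_
  obtain ⟨a, ha, hau⟩ := hB u hu
  obtain ⟨s, hs⟩ : ∃ s, h.endVertex s = .inl v := by
    by_contra hs
    exact hvQ (hQ v hs)
  exact (h.endGraph_adj_or_samePath hau hs huv).resolve_left fun hadj =>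
    hvJ (hJ v ⟨s, ⟨a, ha, hadj⟩, hs⟩)

/-- `δ` makes up for missing weight at the end vertices and for the weight absorbed by inner
vertices. -/
theorem linkingCondition_endGraph [Fintype I] (hw : IsFracTour w)
    (h : IsPathPartition (addUniversal G T) P) (hI : 2 ≤ Fintype.card I)
    (hend : ∀ d, ∃ s, h.endVertex s = .inr d) {δ : V → ℝ} (hδ : ∀ u, 0 ≤ δ u)
    (hends : ∀ u, (∃ s, h.endVertex s = .inl u) →
      ({s | h.endVertex s = .inl u}.ncard : ℝ) ≤ weightOff w (SamePath P) u + δ u)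
    (hinner : ∀ u, (¬ ∃ s, h.endVertex s = .inl u) → weightOff w (SamePath P) u ≤ δ u)
    (hlt : nonEdgeWeight G w + (∑ u, δ u) / 2 < T + 1) : LinkingCondition h.endGraph := by
  classical
  intro A
  by_cases hAinl : ∃ a ∈ A, ∃ d, h.endVertex a = .inr d
  · obtain ⟨a, ha, d, hd⟩ := hAinl
    exact h.card_le_two_mul_ncard_of_universal hI ha hd
  push Not at hAinl
  rcases Nat.lt_or_ge 1 A.card with hA | hA
  swap
  · omega
  set B : Finset V := {u | ∃ a ∈ A, h.endVertex a = .inl u}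
  set J : Finset V := {v | ∃ s, (∃ a ∈ A, h.endGraph.Adj a s) ∧ h.endVertex s = .inl v}
  set Q : Finset V := {u | ¬ ∃ s, h.endVertex s = .inl u}
  have hBend : ∀ u ∈ B, ∃ s, h.endVertex s = .inl u := fun u hu =>
    let ⟨a, _, ha⟩ := (Finset.mem_filter.1 hu).2; ⟨a, ha⟩
  have hcount : ∑ u ∈ B, weightOff w (SamePath P) u ≤ _ :=
    hw.sum_weightOff_samePath_le h (J := J) (Q := Q) (fun u hu => (Finset.mem_filter.1 hu).2)
      (by simp [J]) (by simp [Q])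
  have hJcard : J.card + T ≤ _ :=
    h.card_add_le_ncard hA hAinl hend fun v hv => (Finset.mem_filter.1 hv).2
  have hAB := h.card_le_sum_ncard (A := A) (B := B) fun a ha => by
    rcases hu : h.endVertex a with u | d
    · exact ⟨u, Finset.mem_filter.2 ⟨Finset.mem_univ u, a, ha, hu⟩, rfl⟩
    · exact absurd hu (hAinl a ha d)
  have hBcard : (A.card : ℝ) ≤ ∑ u ∈ B, (weightOff w (SamePath P) u + δ u) := by
    refine (Nat.cast_le.2 hAB).trans ?_
    rw [Nat.cast_sum]
    exact Finset.sum_le_sum fun u hu => hends u (hBend u hu)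
  have hQδ : ∑ u ∈ Q, weightOff w (SamePath P) u ≤ ∑ u ∈ Q, δ u :=
    Finset.sum_le_sum fun u hu => hinner u (Finset.mem_filter.1 hu).2
  have hdisj : Disjoint B Q := Finset.disjoint_left.2 fun u hu hu' =>
    (Finset.mem_filter.1 hu').2 (hBend u hu)
  have hBQ : ∑ u ∈ B ∪ Q, δ u ≤ ∑ u, δ u := Finset.sum_le_univ_sum_of_nonneg hδ
  rw [Finset.sum_union hdisj] at hBQ
  rw [Finset.sum_add_distrib] at hBcard
  have hlt' : (A.card : ℝ) < (2 * (J.card + T) + 2 : ℕ) := by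
    push_cast
    linarith
  have := Nat.cast_lt.1 hlt'
  omega

end IsFracTour

namespace IsFracTour

variable {V I : Type*} [Fintype V] [DecidableEq V] {G : SimpleGraph V} {w : V → V → ℝ} {T : ℕ}

lemma linkingCondition_of_pairs [Fintype I] (hw : IsFracTour w) {P : I → List (V ⊕ Fin T)}
    (h : IsPathPartition (addUniversal G T) P) (hI : 2 ≤ Fintype.card I) {S : Set (V ⊕ Fin T)}
    (hpair : ∀ x ∉ S, ∃ i y, P i = [x, y] ∨ P i = [y, x])
    (hend : ∀ d, .inr d ∈ S → ∃ s, h.endVertex s = .inr d) {δ : V → ℝ} (hδ : ∀ u, 0 ≤ δ u)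
    (hends : ∀ u, .inl u ∈ S → (∃ s, h.endVertex s = .inl u) →
      ({s | h.endVertex s = .inl u}.ncard : ℝ) ≤ weightOff w (SamePath P) u + δ u)
    (hinner : ∀ u, .inl u ∈ S → (¬ ∃ s, h.endVertex s = .inl u) →
      weightOff w (SamePath P) u ≤ δ u)
    (hlt : nonEdgeWeight G w + (∑ u, δ u) / 2 < T + 1) : LinkingCondition h.endGraph := by
  refine hw.linkingCondition_endGraph h hI (fun d => ?_) hδ (fun u hu => ?_) (fun u hu => ?_) hlt
  · by_cases hd : .inr d ∈ S
    · exact hend d hd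
    · obtain ⟨i, y, hi⟩ := hpair _ hd
      exact h.exists_endVertex_of_pair hi
  · by_cases huS : .inl u ∈ S
    · exact hends u huS hu
    · obtain ⟨i, y, hi⟩ := hpair _ huS
      have hle : {s | h.endVertex s = .inl u}.ncard ≤ 1 :=
        h.ncard_endVertex_le_one (i := i) (by rcases hi with hi | hi <;> simp [hi])
          (by rcases hi with hi | hi <;> simp [hi])
      have hleR : ({s | h.endVertex s = .inl u}.ncard : ℝ) ≤ 1 := by exact_mod_cast hle
      linarith [hw.one_le_weightOff_of_pair h hi, hδ u]
  · by_cases huS : .inl u ∈ S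
    · exact hinner u huS hu
    · obtain ⟨i, y, hi⟩ := hpair _ huS
      exact absurd (h.exists_endVertex_of_pair hi) hu

theorem exists_isEnumeration_of_even (hw : IsFracTour w) (hT : nonEdgeWeight G w < T + 1)
    (heven : Even (Fintype.card V + T)) (hcard : 4 ≤ Fintype.card V + T) :
    ∃ (k : ℕ) (l : List (V ⊕ Fin T)), 4 * k ≤ Fintype.card V + T ∧ IsEnumeration l ∧
      breaks (addUniversal G T) l + 1 ≤ k := by
  obtain ⟨σ, hσ⟩ :=
    (hw.isOneTough_addUniversal hT).exists_isMatchingOff_empty (by simpa using heven)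
  obtain ⟨m, P, hP, hm, -, hpair⟩ := IsMatchingOff.exists_isPathPartition (Q := [])
    (by simpa using hσ) (by simp) (by simp) (by simp)
  simp only [List.flatten_nil, List.length_nil, Fintype.card_sum, Fintype.card_fin] at hm
  have hlink : LinkingCondition hP.endGraph :=
    hw.linkingCondition_of_pairs hP (by rw [Fintype.card_fin]; omega) (S := ∅) (δ := 0)
      (fun x _ => hpair x List.not_mem_nil) (by simp) (by simp) (by simp) (by simp)
      (by simpa using hT)
  obtain ⟨k, l, hl, hbreaks, hk, -⟩ := hP.exists_isEnumeration_breaks hlink ⟨0, by omega⟩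
  rw [Fintype.card_fin] at hk
  exact ⟨k, l, by omega, hl, hbreaks⟩

theorem exists_isEnumeration_of_odd (hw : IsFracTour w) (hT : nonEdgeWeight G w < T + 1)
    (hodd : Odd (Fintype.card V + T)) (hcard : 3 ≤ Fintype.card V + T) (x : V ⊕ Fin T) :
    ∃ (k : ℕ) (l : List (V ⊕ Fin T)), 4 * k ≤ Fintype.card V + T + 1 ∧ IsEnumeration l ∧
      breaks (addUniversal G T) l + 1 ≤ k ∧
      (4 * k = Fintype.card V + T + 1 → ∃ l', l = x :: l') := by
  obtain ⟨σ, hσ⟩ :=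
    (hw.isOneTough_addUniversal hT).exists_isMatchingOff_singleton (by simpa using hodd) x
  obtain ⟨m, P, hP, hm, hQ, hpair⟩ := IsMatchingOff.exists_isPathPartition (Q := [[x]])
    (by simpa using hσ) (by simp) (by simp) (by simp)
  obtain ⟨i₀, hi₀⟩ := hQ [x] (by simp)
  simp only [List.flatten_cons, List.flatten_nil, List.append_nil, List.length_singleton,
    Fintype.card_sum, Fintype.card_fin] at hm
  have hlink : LinkingCondition hP.endGraph := by
    refine hw.linkingCondition_of_pairs hP (by rw [Fintype.card_fin]; omega) (S := {x}) (δ := 0)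
      (fun y hy => hpair y (by simpa using hy)) ?_ (fun _ => le_rfl) ?_ ?_ (by simpa using hT)
    · rintro d rfl
      exact ⟨_, hP.endVertex_true_of_eq_cons hi₀⟩
    · rintro u rfl -
      rw [hw.weightOff_samePath hP (i := i₀) (F := {u}) (by simp [hi₀]) (by simp [hi₀]),
        Finset.sum_singleton, hw.self, Pi.zero_apply, sub_zero, add_zero]
      exact_mod_cast hP.ncard_endVertex_le_two (.inl u)
    · rintro u rfl hu
      exact absurd ⟨_, hP.endVertex_true_of_eq_cons hi₀⟩ hu
  obtain ⟨k, l, hl, hbreaks, hk, hhead⟩ := hP.exists_isEnumeration_breaks hlink i₀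
  rw [Fintype.card_fin] at hk hhead
  refine ⟨k, l, by omega, hl, hbreaks, fun hk' => ?_⟩
  obtain ⟨b, l', rfl⟩ := hhead (by omega)
  exact ⟨l', by cases b <;> simp [orient, hi₀]⟩

lemma weightOff_samePath_of_triple (hw : IsFracTour w) {P : I → List (V ⊕ Fin T)}
    (h : IsPathPartition (addUniversal G T) P) {p q r : V} {i : I}
    (hi : P i = [.inl p, .inl q, .inl r]) {u : V} (hu : .inl u ∈ P i) :
    weightOff w (SamePath P) u = 2 - (w u p + w u q + w u r) := by
  have hnodup := h.nodup i
  simp only [hi, List.nodup_cons, List.mem_cons, Sum.inl.injEq, List.not_mem_nil, or_false,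
    not_or] at hnodup
  obtain ⟨⟨hpq, hpr⟩, hqr, -⟩ := hnodup
  rw [hw.weightOff_samePath h hu (F := {p, q, r}) (by simp [hi]),
    Finset.sum_insert (by simp [hpq, hpr]), Finset.sum_pair hqr, add_assoc]

/-- The inner vertex `q` of the path `p, q, r` absorbs the weight `2 - w p q - w q r`, and `p` (or
`r`) lacks weight only if more than `1` of it goes to the other two vertices. -/
lemma linkingCondition_of_triple [Fintype I] (hw : IsFracTour w) {P : I → List (V ⊕ Fin T)}
    (h : IsPathPartition (addUniversal G T) P) (hI : 2 ≤ Fintype.card I) {p q r : V} (hpq : p ≠ q)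
    (hqr : q ≠ r) (hpr : p ≠ r) {i₀ : I} (hi₀ : P i₀ = [.inl p, .inl q, .inl r])
    (hpair : ∀ x ∉ ({.inl p, .inl q, .inl r} : Set (V ⊕ Fin T)),
      ∃ i y, P i = [x, y] ∨ P i = [y, x])
    (hlt : nonEdgeWeight G w + (max 0 (w p q + w p r - 1) + (2 - w p q - w q r) +
      max 0 (w q r + w p r - 1)) / 2 < T + 1) : LinkingCondition h.endGraph := by
  have hoff {u : V} := hw.weightOff_samePath_of_triple h hi₀ (u := u)
  have hnum : ∀ u, .inl u ∈ P i₀ → ({s | h.endVertex s = .inl u}.ncard : ℝ) ≤ 1 :=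
    fun u hu => by exact_mod_cast h.ncard_endVertex_le_one hu (by simp [hi₀])
  have hp : h.endVertex (i₀, true) = .inl p := h.endVertex_true_of_eq_cons hi₀
  have hr : h.endVertex (i₀, false) = .inl r :=
    h.endVertex_false_of_eq_append (l := [.inl p, .inl q]) hi₀
  have hq : ¬ ∃ s, h.endVertex s = .inl q := h.not_exists_endVertex_of_triple hi₀
  obtain ⟨hp0, hq0, hr0⟩ : w p p = 0 ∧ w q q = 0 ∧ w r r = 0 := ⟨hw.self p, hw.self q, hw.self r⟩
  have hq1 : 0 ≤ 2 - w p q - w q r := by linarith [hw.le_one p q, hw.le_one q r]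
  refine hw.linkingCondition_of_pairs h hI hpair (by simp)
    (δ := Pi.single p (max 0 (w p q + w p r - 1)) + Pi.single q (2 - w p q - w q r) +
      Pi.single r (max 0 (w q r + w p r - 1))) ?_ ?_ ?_ ?_
  · rw [← Pi.le_def]
    exact add_nonneg (add_nonneg (Pi.single_nonneg.2 (le_max_left _ _)) (Pi.single_nonneg.2 hq1))
      (Pi.single_nonneg.2 (le_max_left _ _))
  · rintro u (hu | hu | hu) hend <;> obtain rfl := Sum.inl_injective hu
    · have := hnum u (by simp [hi₀])
      have := le_max_right 0 (w u q + w u r - 1)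
      rw [hoff (by simp [hi₀])]
      simp only [Pi.add_apply, Pi.single_eq_same, Pi.single_eq_of_ne hpq, Pi.single_eq_of_ne hpr]
      linarith
    · exact absurd hend hq
    · have := hnum u (by simp [hi₀])
      have := le_max_right 0 (w q u + w p u - 1)
      rw [hoff (by simp [hi₀])]
      simp only [Pi.add_apply, Pi.single_eq_same, Pi.single_eq_of_ne hpr.symm,
        Pi.single_eq_of_ne hqr.symm]
      linarith [hw.symm p u, hw.symm q u]
  · rintro u (hu | hu | hu) hend <;> obtain rfl := Sum.inl_injective hu
    · exact absurd ⟨_, hp⟩ hend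
    · rw [hoff (by simp [hi₀])]
      simp only [Pi.add_apply, Pi.single_eq_same, Pi.single_eq_of_ne hpq.symm,
        Pi.single_eq_of_ne hqr]
      linarith [hw.symm p u]
    · exact absurd ⟨_, hr⟩ hend
  · simpa [Finset.sum_add_distrib] using hlt

theorem exists_isEnumeration_of_triple (hw : IsFracTour w) (hcard : 4 ≤ Fintype.card V + T)
    {p q r : V} (hpq : G.Adj p q) (hqr : G.Adj q r) (hpr : p ≠ r) {σ : V ⊕ Fin T → V ⊕ Fin T}
    (hσ : IsMatchingOff (addUniversal G T) {.inl p, .inl q, .inl r} σ)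
    (hlt : nonEdgeWeight G w + (max 0 (w p q + w p r - 1) + (2 - w p q - w q r) +
      max 0 (w q r + w p r - 1)) / 2 < T + 1) :
    ∃ (k : ℕ) (l : List (V ⊕ Fin T)), 4 * k + 1 ≤ Fintype.card V + T ∧ IsEnumeration l ∧
      breaks (addUniversal G T) l + 1 ≤ k := by
  obtain ⟨m, P, hP, hm, hQ, hpair⟩ := IsMatchingOff.exists_isPathPartition
    (Q := [[Sum.inl p, Sum.inl q, Sum.inl r]]) (by convert hσ; simp; rfl) (by simp)
    (by simp [addUniversal_adj_inl, hpq, hqr]) (by simp [hpq.ne, hqr.ne, hpr])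
  obtain ⟨i₀, hi₀⟩ := hQ [.inl p, .inl q, .inl r] (by simp)
  simp only [List.flatten_cons, List.flatten_nil, List.append_nil, List.length_cons,
    List.length_nil, Fintype.card_sum, Fintype.card_fin] at hm
  have hlink : LinkingCondition hP.endGraph :=
    hw.linkingCondition_of_triple hP (by rw [Fintype.card_fin]; omega) hpq.ne hqr.ne hpr hi₀
      (fun x hx => hpair x (by simpa using hx)) hlt
  obtain ⟨k, l, hl, hbreaks, hk, -⟩ := hP.exists_isEnumeration_breaks hlink i₀
  rw [Fintype.card_fin] at hk
  exact ⟨k, l, by omega, hl, hbreaks⟩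

end IsFracTour

lemma IsMatchingOff.insert_pair {W : Type*} {G : SimpleGraph W} {X : Set W} {σ : W → W}
    (hσ : IsMatchingOff G X σ) {a : W} (ha : a ∉ X) :
    IsMatchingOff G (insert a (insert (σ a) X)) σ := by
  obtain ⟨-, -, hσσ⟩ := hσ a ha
  intro u hu
  simp only [Set.mem_insert_iff, not_or] at hu ⊢
  obtain ⟨hua, huσ, huX⟩ := hu
  obtain ⟨hX, hadj, hu⟩ := hσ u huX
  exact ⟨⟨fun h => huσ (by rw [← hu, h]), fun h => hua (by rw [← hu, h, hσσ]), hX⟩, hadj, hu⟩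

namespace IsFracTour

variable {V : Type*} [Fintype V] [DecidableEq V] {G : SimpleGraph V} {w : V → V → ℝ}

lemma triangle_le (hw : IsFracTour w) (hcard : 4 ≤ Fintype.card V) {p q r : V}
    (hpq : p ≠ q) (hqr : q ≠ r) (hpr : p ≠ r) : w p q + w q r + w p r ≤ 2 := by
  have hsum : ∀ f : V → ℝ, ∑ u ∈ {p, q, r}, f u = f p + (f q + f r) := fun f => by
    rw [Finset.sum_insert (by simp [hpq, hpr]), Finset.sum_pair hqr]
  have hcompl : ∀ u, ∑ v ∈ ({p, q, r} : Finset V)ᶜ, w u v = 2 - (w u p + (w u q + w u r)) :=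
    fun u => by rw [eq_sub_iff_add_eq', ← hsum, Finset.sum_add_sum_compl, hw.degree]
  have hne : ({p, q, r} : Finset V) ≠ Finset.univ := fun h => by
    have := Finset.card_le_three (a := p) (b := q) (c := r)
    rw [h, Finset.card_univ] at this
    omega
  have hcut := hw.cut {p, q, r} (by simp) hne
  simp only [hsum, hcompl, hw.self, hw.symm q p, hw.symm r] at hcut
  linarith

lemma weightOff_adj_le (hw : IsFracTour w) (G : SimpleGraph V) (v : V) :
    weightOff w G.Adj v ≤ nonEdgeWeight G w := by
  classical
  have hback : weightOff w G.Adj v ≤ ∑ u ∈ Finset.univ.erase v, weightOff w G.Adj u := by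
    rw [weightOff, ← Finset.sum_erase _ (hw.self v)]
    refine (Finset.sum_le_sum fun u hu => ?_).trans (Finset.sum_le_sum_of_subset_of_nonneg
      (Finset.erase_subset_erase v (Finset.subset_univ _)) fun u _ _ => hw.weightOff_nonneg _ u)
    have hvu : v ∈ Finset.univ.filter fun x => ¬ G.Adj u x := by
      simpa [G.adj_comm] using Finset.mem_of_mem_erase hu
    rw [hw.symm]
    exact Finset.single_le_sum (f := w u) (fun x _ => hw.nonneg u x) hvu
  rw [nonEdgeWeight, ← Finset.add_sum_erase _ _ (Finset.mem_univ v)]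
  linarith

lemma le_nonEdgeWeight (hw : IsFracTour w) {u v : V} (huv : ¬ G.Adj u v) :
    w u v ≤ nonEdgeWeight G w := by
  classical
  refine le_trans ?_ (hw.weightOff_adj_le G u)
  exact Finset.single_le_sum (f := w u) (fun x _ => hw.nonneg u x) (by simpa using huv)

lemma exists_adj_le (hw : IsFracTour w) (hlt : nonEdgeWeight G w < 2) (v : V) :
    ∃ a, G.Adj v a ∧ 2 - nonEdgeWeight G w ≤ (Fintype.card V - 1 : ℝ) * w v a := by
  classical
  have hsum : 2 - nonEdgeWeight G w ≤ ∑ a with G.Adj v a, w v a := by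
    have hsplit := Finset.sum_filter_add_sum_filter_not Finset.univ (G.Adj v) (w v)
    have hoff := hw.weightOff_adj_le G v
    rw [hw.degree] at hsplit
    rw [weightOff] at hoff
    linarith
  have hne : (Finset.univ.filter (G.Adj v)).Nonempty := by
    by_contra h
    rw [Finset.not_nonempty_iff_eq_empty.1 h, Finset.sum_empty] at hsum
    linarith
  obtain ⟨a, ha, hmax⟩ := Finset.exists_max_image _ (w v) hne
  refine ⟨a, (Finset.mem_filter.1 ha).2, hsum.trans <|
    (Finset.sum_le_card_nsmul _ _ _ hmax).trans ?_⟩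
  rw [nsmul_eq_mul]
  refine mul_le_mul_of_nonneg_right ?_ (hw.nonneg _ _)
  have hlt : (Finset.univ.filter (G.Adj v)).card < Fintype.card V :=
    Finset.card_lt_univ_of_notMem (x := v) (by simp)
  have hle : ((Finset.univ.filter (G.Adj v)).card : ℝ) + 1 ≤ Fintype.card V := by exact_mod_cast hlt
  linarith

lemma exists_isEnumeration_of_triple_of_lt (hw : IsFracTour w) (hcard : 4 ≤ Fintype.card V)
    {p q r : V} (hpq : G.Adj p q) (hqr : G.Adj q r) (hpr : p ≠ r) {σ : V ⊕ Fin 0 → V ⊕ Fin 0}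
    (hσ : IsMatchingOff (addUniversal G 0) {.inl p, .inl q, .inl r} σ)
    (hsum : 2 * nonEdgeWeight G w < w p q + w q r)
    (hpq' : 2 * nonEdgeWeight G w + w p r < 1 + w p q)
    (hqr' : 2 * nonEdgeWeight G w + w p r < 1 + w q r) (hpr' : nonEdgeWeight G w + w p r < 1) :
    ∃ (k : ℕ) (l : List (V ⊕ Fin 0)), 4 * k + 1 ≤ Fintype.card V ∧ IsEnumeration l ∧
      breaks (addUniversal G 0) l + 1 ≤ k := by
  refine hw.exists_isEnumeration_of_triple (T := 0) hcard hpq hqr hpr hσ ?_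
  rcases max_cases 0 (w p q + w p r - 1) with ⟨h, -⟩ | ⟨h, -⟩ <;>
    rcases max_cases 0 (w q r + w p r - 1) with ⟨h', -⟩ | ⟨h', -⟩ <;> rw [h, h'] <;> norm_num <;>
    linarith

lemma exists_isEnumeration_of_triangle (hw : IsFracTour w) (hcard : 4 ≤ Fintype.card V)
    {p q r : V} (hpq : G.Adj p q) (hqr : G.Adj q r) (hpr : G.Adj p r) {σ : V ⊕ Fin 0 → V ⊕ Fin 0}
    (hσ : IsMatchingOff (addUniversal G 0) {.inl p, .inl q, .inl r} σ)
    (hsmall : 3 * nonEdgeWeight G w < 1) (hsum : 3 * nonEdgeWeight G w < w p q + w q r + w p r) :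
    ∃ (k : ℕ) (l : List (V ⊕ Fin 0)), 4 * k + 1 ≤ Fintype.card V ∧ IsEnumeration l ∧
      breaks (addUniversal G 0) l + 1 ≤ k := by
  have hle := hw.triangle_le hcard hpq.ne hqr.ne hpr.ne
  have := hw.nonEdgeWeight_nonneg G
  have hmin {p q r : V} (hpq : G.Adj p q) (hqr : G.Adj q r) (hpr : p ≠ r)
      (hσ : IsMatchingOff (addUniversal G 0) {.inl p, .inl q, .inl r} σ)
      (hle : w p q + w q r + w p r ≤ 2) (hsum : 3 * nonEdgeWeight G w < w p q + w q r + w p r)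
      (hrp : w p r ≤ w p q) (hrq : w p r ≤ w q r) :=
    hw.exists_isEnumeration_of_triple_of_lt hcard hpq hqr hpr hσ (by linarith) (by linarith)
      (by linarith) (by linarith)
  rcases le_total (w p r) (w p q) with hrp | hrp
  · rcases le_total (w p r) (w q r) with hrq | hrq
    · exact hmin hpq hqr hpr.ne hσ hle hsum hrp hrq
    · refine hmin hpq.symm hpr hqr.ne (by rwa [Set.insert_comm]) ?_ ?_ ?_ hrq <;>
        linarith [hw.symm p q]
  · rcases le_total (w p q) (w q r) with hqp | hqp
    · refine hmin hpr hqr.symm hpq.ne (by rwa [Set.pair_comm]) ?_ ?_ hrp ?_ <;>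
        linarith [hw.symm q r]
    · refine hmin hpq.symm hpr hqr.ne (by rwa [Set.insert_comm]) ?_ ?_ ?_ ?_ <;>
        linarith [hw.symm p q]

/-- The vertex `v` missed by a matching is appended to the matching edge of a vertex `a` for which
`w v a` is large. -/
theorem exists_isEnumeration_of_odd_of_small (hw : IsFracTour w) (hodd : Odd (Fintype.card V))
    (hcard : 4 ≤ Fintype.card V)
    (hsmall : (3 * (Fintype.card V - 1 : ℝ) + 1) * nonEdgeWeight G w < 2) :
    ∃ (k : ℕ) (l : List (V ⊕ Fin 0)), 4 * k + 1 ≤ Fintype.card V ∧ IsEnumeration l ∧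
      breaks (addUniversal G 0) l + 1 ≤ k := by
  classical
  have ht := hw.nonEdgeWeight_nonneg G
  have hcardR : (4 : ℝ) ≤ Fintype.card V := by exact_mod_cast hcard
  have hlt : nonEdgeWeight G w < 1 := by nlinarith
  obtain ⟨v⟩ : Nonempty V := Fintype.card_pos_iff.1 (by omega)
  have htough : IsOneTough (addUniversal G 0) := hw.isOneTough_addUniversal (by simpa using hlt)
  obtain ⟨σ, hσ⟩ := htough.exists_isMatchingOff_singleton (by simpa using hodd) (.inl v)
  obtain ⟨a, hva, ha⟩ := hw.exists_adj_le (by linarith) v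
  have hheavy : 3 * nonEdgeWeight G w < w v a := by
    have : (Fintype.card V - 1 : ℝ) * (3 * nonEdgeWeight G w) < (Fintype.card V - 1) * w v a := by
      linarith
    exact lt_of_mul_lt_mul_left this (by linarith)
  have haX : Sum.inl a ∉ ({.inl v} : Set (V ⊕ Fin 0)) := by simpa using hva.ne'
  obtain ⟨hbv, hab, -⟩ := hσ _ haX
  have hσ' := hσ.insert_pair haX
  rcases hb : σ (.inl a) with b | d
  swap
  · exact d.elim0
  rw [hb] at hbv hab hσ'
  rw [addUniversal_adj_inl] at hab
  have hvb : v ≠ b := by simpa [eq_comm] using hbv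
  have hσ'' : IsMatchingOff (addUniversal G 0) {.inl v, .inl a, .inl b} σ := by
    convert hσ' using 1
    grind
  by_cases hadj : G.Adj v b
  · exact hw.exists_isEnumeration_of_triangle hcard hva hab hadj hσ''
      (by linarith [hw.le_one v a]) (by linarith [hw.nonneg a b, hw.nonneg v b])
  · have := hw.le_nonEdgeWeight hadj
    have := hw.nonneg a b
    have := hw.le_one v a
    exact hw.exists_isEnumeration_of_triple_of_lt hcard hva hab hvb hσ'' (by linarith) (by linarith)
      (by linarith) (by linarith)

end IsFracTour

namespace IsFracTour

variable {V : Type*} [Fintype V] [DecidableEq V] {G : SimpleGraph V} {w : V → V → ℝ} {T : ℕ}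

lemma exists_four_mul_breaks_le (hw : IsFracTour w) (hcard : 4 ≤ Fintype.card V)
    (hT : nonEdgeWeight G w < T + 1) (hparity : Even (Fintype.card V + T) ∨ 0 < T) :
    ∃ l : List V, IsEnumeration l ∧ 4 * (breaks G l + 1) ≤ Fintype.card V + 5 * T := by
  rcases Nat.even_or_odd (Fintype.card V + T) with heven | hodd
  · obtain ⟨k, l, hk, hl, hbreaks⟩ := hw.exists_isEnumeration_of_even hT heven (by omega)
    have := hl.breaks_filterMap_getLeft?_le (G := G)
    exact ⟨_, hl.filterMap_getLeft?, by omega⟩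
  have hTpos : 0 < T := hparity.resolve_left (Nat.not_even_iff_odd.2 hodd)
  obtain ⟨k, l, hk, hl, hbreaks, hhead⟩ :=
    hw.exists_isEnumeration_of_odd hT hodd (by omega) (.inr ⟨0, hTpos⟩)
  refine ⟨_, hl.filterMap_getLeft?, ?_⟩
  by_cases hk' : 4 * k = Fintype.card V + T + 1
  · obtain ⟨l', rfl⟩ := hhead hk'
    have := hl.breaks_filterMap_getLeft?_cons_lt (G := G)
    simp only [List.filterMap_cons, Sum.getLeft?_inr]
    omega
  · have := hl.breaks_filterMap_getLeft?_le (G := G)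
    have := Nat.odd_iff.1 hodd
    omega

lemma exists_four_mul_breaks_le_of_odd (hw : IsFracTour w) (hcard : 3 ≤ Fintype.card V)
    (hodd : Odd (Fintype.card V)) (hlt : nonEdgeWeight G w < 1) :
    ∃ l : List V, IsEnumeration l ∧ 4 * (breaks G l + 1) ≤ Fintype.card V + 1 := by
  obtain ⟨v⟩ : Nonempty V := Fintype.card_pos_iff.1 (by omega)
  obtain ⟨k, l, hk, hl, hbreaks, -⟩ :=
    hw.exists_isEnumeration_of_odd (T := 0) (by simpa using hlt) hodd hcard (.inl v)
  have := hl.breaks_filterMap_getLeft?_le (G := G)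
  exact ⟨_, hl.filterMap_getLeft?, by omega⟩

lemma exists_four_mul_breaks_le_of_small (hw : IsFracTour w) (hcard : 4 ≤ Fintype.card V)
    (hodd : Odd (Fintype.card V))
    (hsmall : (3 * (Fintype.card V - 1 : ℝ) + 1) * nonEdgeWeight G w < 2) :
    ∃ l : List V, IsEnumeration l ∧ 4 * (breaks G l + 1) ≤ Fintype.card V := by
  obtain ⟨k, l, hk, hl, hbreaks⟩ := hw.exists_isEnumeration_of_odd_of_small hodd hcard hsmall
  have := hl.breaks_filterMap_getLeft?_le (G := G)
  exact ⟨_, hl.filterMap_getLeft?, by omega⟩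

lemma exists_fifteen_mul_breaks_le_of_odd (hw : IsFracTour w) (hcard : 4 ≤ Fintype.card V)
    (hodd : Odd (Fintype.card V)) (hlt : nonEdgeWeight G w < 1) :
    ∃ l : List V, IsEnumeration l ∧
      15 * (breaks G l + 1 : ℝ) ≤ 4 * Fintype.card V + 19 * nonEdgeWeight G w := by
  have ht := hw.nonEdgeWeight_nonneg G
  by_cases hsmall : (3 * (Fintype.card V - 1 : ℝ) + 1) * nonEdgeWeight G w < 2
  · obtain ⟨l, hl, hbreaks⟩ := hw.exists_four_mul_breaks_le_of_small hcard hodd hsmall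
    have : 4 * (breaks G l + 1 : ℝ) ≤ Fintype.card V := by exact_mod_cast hbreaks
    exact ⟨l, hl, by linarith⟩
  obtain ⟨l, hl, hbreaks⟩ := hw.exists_four_mul_breaks_le_of_odd (by omega) hodd hlt
  refine ⟨l, hl, ?_⟩
  by_cases hle : 15 * (breaks G l + 1) ≤ 4 * Fintype.card V
  · have : 15 * (breaks G l + 1 : ℝ) ≤ 4 * Fintype.card V := by exact_mod_cast hle
    linarith
  have hmod := Nat.odd_iff.1 hodd
  have hexcept : Fintype.card V = 7 ∧ breaks G l ≤ 1 ∨ Fintype.card V = 11 ∧ breaks G l ≤ 2 := by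
    omega
  rcases hexcept with ⟨hn, hb⟩ | ⟨hn, hb⟩ <;> rw [hn] at hsmall ⊢ <;> norm_num at hsmall ⊢
  · have : (breaks G l : ℝ) ≤ 1 := by exact_mod_cast hb
    linarith
  · have : (breaks G l : ℝ) ≤ 2 := by exact_mod_cast hb
    linarith

theorem exists_fifteen_mul_breaks_le (hw : IsFracTour w) (G : SimpleGraph V)
    (hcard : 4 ≤ Fintype.card V) :
    ∃ l : List V, IsEnumeration l ∧
      15 * (breaks G l + 1 : ℝ) ≤ 4 * Fintype.card V + 19 * nonEdgeWeight G w := by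
  obtain ⟨T, hle, hlt⟩ : ∃ T : ℕ, (T : ℝ) ≤ nonEdgeWeight G w ∧ nonEdgeWeight G w < T + 1 :=
    ⟨_, Nat.floor_le (hw.nonEdgeWeight_nonneg G), Nat.lt_floor_add_one _⟩
  by_cases hparity : Even (Fintype.card V + T) ∨ 0 < T
  · obtain ⟨l, hl, hbreaks⟩ := hw.exists_four_mul_breaks_le hcard hlt hparity
    have : 4 * (breaks G l + 1 : ℝ) ≤ Fintype.card V + 5 * T := by exact_mod_cast hbreaks
    exact ⟨l, hl, by linarith⟩
  · simp only [not_or, Nat.not_even_iff_odd, not_lt, Nat.le_zero] at hparity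
    obtain ⟨hodd, rfl⟩ := hparity
    exact hw.exists_fifteen_mul_breaks_le_of_odd hcard hodd (by simpa using hlt)

end IsFracTour

/-! ### Tours -/

section Tours

variable {V : Type*}

/-- The graph of the edges of cost `1`. -/
def costOneGraph (c : Sym2 V → ℝ) : SimpleGraph V where
  Adj u v := u ≠ v ∧ c s(u, v) = 1
  symm := ⟨fun u v h => ⟨h.1.symm, by rw [Sym2.eq_swap]; exact h.2⟩⟩
  loopless := ⟨fun _ h => h.1 rfl⟩

lemma exists_isPath_support_eq {l : List V} (hl : l.Nodup) (hne : l ≠ []) :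
    ∃ (u v : V) (p : (⊤ : SimpleGraph V).Walk u v), p.IsPath ∧ p.support = l := by
  have hchain : l.IsChain (⊤ : SimpleGraph V).Adj := (List.Pairwise.imp id hl).isChain
  have hsupport := SimpleGraph.Walk.support_ofSupport hne hchain
  exact ⟨_, _, .ofSupport l hne hchain, .mk' (hsupport.symm ▸ hl), hsupport⟩

lemma walkCost_eq_sum [DecidableEq V] (c : Sym2 V → ℝ) {v : V} {p : (⊤ : SimpleGraph V).Walk v v}
    (hp : p.IsHamiltonianCycle) : walkCost c p = ∑ e ∈ p.edges.toFinset, c e :=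
  (List.sum_toFinset c hp.isCycle.edges_nodup).symm

lemma tourCosts_finite [Finite V] [DecidableEq V] (c : Sym2 V → ℝ) : (tourCosts c).Finite := by
  refine (Set.finite_range fun s : Finset (Sym2 V) => ∑ e ∈ s, c e).subset ?_
  rintro _ ⟨v, p, hp, rfl⟩
  exact ⟨_, (walkCost_eq_sum c hp).symm⟩

variable [Fintype V] [DecidableEq V]

lemma mem_edges_iff {u v : V} : s(u, v) ∈ edges V ↔ u ≠ v := by
  simp [edges]

lemma sum_map_edges_le_length_add_breaks {c : Sym2 V → ℝ}
    (hc : ∀ e ∈ edges V, c e = 1 ∨ c e = 2) :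
    ∀ {u v : V} (p : (⊤ : SimpleGraph V).Walk u v),
      (p.edges.map c).sum ≤ p.length + breaks (costOneGraph c) p.support
  | _, _, .nil => by simp
  | _, _, .cons (u := u) (v := v) (h : u ≠ v) p => by
      have ih := sum_map_edges_le_length_add_breaks hc p
      rw [← p.cons_tail_support] at ih
      rw [SimpleGraph.Walk.support_cons, ← p.cons_tail_support]
      simp only [SimpleGraph.Walk.edges_cons, List.map_cons, List.sum_cons,
        SimpleGraph.Walk.length_cons, breaks]
      push_cast
      rcases hc _ (mem_edges_iff.2 h) with hone | htwo
      · rw [if_pos ⟨h, hone⟩, hone]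
        linarith
      · rw [if_neg fun hadj => by linarith [hadj.2], htwo]
        linarith

lemma exists_isHamiltonianCycle_cons {u v : V} {p : (⊤ : SimpleGraph V).Walk u v} (hp : p.IsPath)
    (hlength : p.length + 1 = Fintype.card V) (hcard : 3 ≤ Fintype.card V) :
    ∃ h : (⊤ : SimpleGraph V).Adj v u, (p.cons h).IsHamiltonianCycle := by
  have hne : v ≠ u := by
    rintro rfl
    rw [(SimpleGraph.Walk.isPath_iff_nil.1 hp).length_eq_zero] at hlength
    omega
  refine ⟨hne, SimpleGraph.Walk.isHamiltonianCycle_iff_isCycle_and_length_eq.2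
    ⟨SimpleGraph.Walk.isCycle_iff_isPath_tail_and_le_length.2 ⟨by simpa using hp, ?_⟩, ?_⟩⟩ <;>
  rw [SimpleGraph.Walk.length_cons] <;> omega

lemma IsEnumeration.exists_isHamiltonianCycle {l : List V} (hl : IsEnumeration l)
    (hcard : 3 ≤ Fintype.card V) :
    ∃ (u v : V) (h : (⊤ : SimpleGraph V).Adj v u) (p : (⊤ : SimpleGraph V).Walk u v),
      p.support = l ∧ (p.cons h).IsHamiltonianCycle := by
  have hne : l ≠ [] := by
    rintro rfl
    have := hl.length_eq
    rw [List.length_nil] at this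
    omega
  obtain ⟨u, v, p, hp, rfl⟩ := exists_isPath_support_eq hl.nodup hne
  obtain ⟨h, hcycle⟩ := exists_isHamiltonianCycle_cons hp
    (by rw [← p.length_support, hl.length_eq]) hcard
  exact ⟨u, v, h, p, rfl, hcycle⟩

lemma tourCosts_nonempty (c : Sym2 V → ℝ) (hcard : 3 ≤ Fintype.card V) :
    (tourCosts c).Nonempty := by
  have hl : IsEnumeration (Finset.univ : Finset V).toList := ⟨Finset.nodup_toList _, by simp⟩
  obtain ⟨u, v, h, p, -, hcycle⟩ := hl.exists_isHamiltonianCycle hcard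
  exact ⟨_, v, _, hcycle, rfl⟩

lemma isLeast_optTour (c : Sym2 V → ℝ) (hcard : 3 ≤ Fintype.card V) :
    IsLeast (tourCosts c) (optTour c) :=
  ⟨(tourCosts_nonempty c hcard).csInf_mem (tourCosts_finite c),
    fun _ h => csInf_le (tourCosts_finite c).bddBelow h⟩

lemma IsEnumeration.optTour_le {l : List V} (hl : IsEnumeration l) (hcard : 3 ≤ Fintype.card V)
    {c : Sym2 V → ℝ} (hc : ∀ e ∈ edges V, c e = 1 ∨ c e = 2) :
    optTour c ≤ Fintype.card V + (breaks (costOneGraph c) l + 1) := by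
  obtain ⟨u, v, h, p, rfl, hcycle⟩ := hl.exists_isHamiltonianCycle hcard
  have hclosing : c s(v, u) ≤ 2 := by
    rcases hc _ (mem_edges_iff.2 h) with hone | htwo <;> linarith
  have hpath := sum_map_edges_le_length_add_breaks hc p
  have hlength : (p.length + 1 : ℝ) = Fintype.card V := by
    exact_mod_cast p.length_support.symm.trans hl.length_eq
  calc optTour c ≤ walkCost c (p.cons h) := (isLeast_optTour c hcard).2 ⟨v, _, hcycle, rfl⟩
    _ = c s(v, u) + (p.edges.map c).sum := by simp [walkCost]
    _ ≤ _ := by linarith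

end Tours

/-! ### The subtour LP -/

section SubtourLP

variable {V : Type*} [DecidableEq V]

/-- The solution `x` of the subtour LP as a weight function on pairs of vertices. It is set to `0`
on the diagonal, where the LP does not constrain `x`. -/
def pairWeight (x : Sym2 V → ℝ) (u v : V) : ℝ := if u = v then 0 else x s(u, v)

lemma pairWeight_self (x : Sym2 V → ℝ) (u : V) : pairWeight x u u = 0 := if_pos rfl

lemma pairWeight_of_ne (x : Sym2 V → ℝ) {u v : V} (h : u ≠ v) : pairWeight x u v = x s(u, v) :=
  if_neg h

lemma pairWeight_symm (x : Sym2 V → ℝ) (u v : V) : pairWeight x u v = pairWeight x v u := by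
  simp only [pairWeight, eq_comm (a := u), Sym2.eq_swap (a := u)]

variable [Fintype V]

lemma cut_subset_edges (S : Finset V) : cut S ⊆ edges V := Finset.filter_subset _ _

lemma sum_cut (S : Finset V) (f : Sym2 V → ℝ) :
    ∑ e ∈ cut S, f e = ∑ u ∈ S, ∑ v ∈ Sᶜ, f s(u, v) := by
  rw [← Finset.sum_product']
  symm
  refine Finset.sum_bij (fun a _ => s(a.1, a.2)) ?_ ?_ ?_ (fun _ _ => rfl)
  · rintro ⟨u, v⟩ h
    simp only [Finset.mem_product, Finset.mem_compl] at h
    refine Finset.mem_filter.2 ⟨mem_edges_iff.2 fun (huv : u = v) => ?_, u, h.1, v, h.2, rfl⟩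
    exact h.2 (huv ▸ h.1)
  · rintro ⟨u, v⟩ h ⟨u', v'⟩ h' heq
    simp only [Finset.mem_product, Finset.mem_compl] at h h'
    rcases Sym2.eq_iff.1 heq with ⟨hu, hv⟩ | ⟨hu, -⟩
    · exact Prod.ext hu hv
    · exact absurd ((show u = v' from hu) ▸ h.1) h'.2
  · intro e he
    obtain ⟨-, u, hu, v, hv, rfl⟩ := Finset.mem_filter.1 he
    exact ⟨(u, v), by simp [hu, hv], rfl⟩

lemma mem_cut_singleton {a b u : V} (hab : a ≠ b) : s(a, b) ∈ cut {u} ↔ u = a ∨ u = b := by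
  simp only [cut, Finset.mem_filter, mem_edges_iff, Finset.mem_singleton]
  constructor
  · rintro ⟨-, i, rfl, j, -, h⟩
    rcases Sym2.eq_iff.1 h with ⟨ha, -⟩ | ⟨-, hb⟩
    · exact .inl ha.symm
    · exact .inr hb.symm
  · rintro (rfl | rfl)
    · exact ⟨hab, u, rfl, b, hab.symm, rfl⟩
    · exact ⟨hab, u, rfl, a, hab, Sym2.eq_swap⟩

lemma sum_sum_cut_singleton (f : Sym2 V → ℝ) :
    ∑ u : V, ∑ e ∈ cut {u}, f e = 2 * ∑ e ∈ edges V, f e := by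
  have hcut : ∀ u : V, ∑ e ∈ cut {u}, f e = ∑ e ∈ edges V, if e ∈ cut {u} then f e else 0 := by
    intro u
    rw [← Finset.sum_filter, Finset.filter_mem_eq_inter,
      Finset.inter_eq_right.2 (cut_subset_edges _)]
  simp_rw [hcut]
  rw [Finset.sum_comm, Finset.mul_sum]
  refine Finset.sum_congr rfl fun e he => ?_
  induction e with
  | _ a b =>
    have hab := mem_edges_iff.1 he
    have hends : (Finset.univ.filter fun u : V => s(a, b) ∈ cut {u}) = {a, b} := by
      ext u
      simp [mem_cut_singleton hab]
    rw [← Finset.sum_filter, hends, Finset.sum_pair hab]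
    ring

lemma sum_cut_eq_pairWeight (x : Sym2 V → ℝ) (S : Finset V) :
    ∑ e ∈ cut S, x e = ∑ u ∈ S, ∑ v ∈ Sᶜ, pairWeight x u v := by
  rw [sum_cut]
  refine Finset.sum_congr rfl fun u hu => Finset.sum_congr rfl fun v hv => ?_
  rw [pairWeight_of_ne]
  rintro rfl
  exact Finset.mem_compl.1 hv hu

lemma sum_cut_singleton_eq_pairWeight (x : Sym2 V → ℝ) (u : V) :
    ∑ e ∈ cut {u}, x e = ∑ v, pairWeight x u v := by
  rw [sum_cut_eq_pairWeight, Finset.sum_singleton,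
    ← Finset.sum_add_sum_compl {u} (fun v => pairWeight x u v), Finset.sum_singleton,
    pairWeight_self, zero_add]

lemma sum_sum_pairWeight (x : Sym2 V → ℝ) :
    ∑ u, ∑ v, pairWeight x u v = 2 * ∑ e ∈ edges V, x e := by
  rw [← sum_sum_cut_singleton]
  exact Finset.sum_congr rfl fun u _ => (sum_cut_singleton_eq_pairWeight x u).symm

lemma sum_cut_compl (x : Sym2 V → ℝ) (S : Finset V) :
    ∑ e ∈ cut Sᶜ, x e = ∑ e ∈ cut S, x e := by
  rw [sum_cut_eq_pairWeight, sum_cut_eq_pairWeight, compl_compl, Finset.sum_comm]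
  exact Finset.sum_congr rfl fun u _ => Finset.sum_congr rfl fun v _ => pairWeight_symm x v u

lemma weightOff_costOneGraph {c : Sym2 V → ℝ} (hc : ∀ e ∈ edges V, c e = 1 ∨ c e = 2)
    (x : Sym2 V → ℝ) (u : V) :
    weightOff (pairWeight x) (costOneGraph c).Adj u =
      ∑ v, (pairWeight (fun e => c e * x e) u v - pairWeight x u v) := by
  rw [weightOff, Finset.sum_filter]
  refine Finset.sum_congr rfl fun v _ => ?_
  by_cases huv : u = v
  · simp [huv, pairWeight_self]
  rw [pairWeight_of_ne _ huv, pairWeight_of_ne _ huv]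
  rcases hc _ (mem_edges_iff.2 huv) with hone | htwo
  · rw [if_neg (not_not.2 ⟨huv, hone⟩), hone]
    ring
  · rw [if_pos fun hadj => by linarith [hadj.2], htwo]
    ring

namespace IsSubtourFeasible

variable {x : Sym2 V → ℝ}

lemma pairWeight_nonneg (hx : IsSubtourFeasible x) (u v : V) : 0 ≤ pairWeight x u v := by
  by_cases h : u = v
  · rw [h, pairWeight_self]
  · rw [pairWeight_of_ne x h]
    exact (hx.bounds _ (mem_edges_iff.2 h)).1

lemma pairWeight_le_one (hx : IsSubtourFeasible x) (u v : V) : pairWeight x u v ≤ 1 := by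
  by_cases h : u = v
  · rw [h, pairWeight_self]
    exact zero_le_one
  · rw [pairWeight_of_ne x h]
    exact (hx.bounds _ (mem_edges_iff.2 h)).2

lemma sum_pairWeight (hx : IsSubtourFeasible x) (u : V) : ∑ v, pairWeight x u v = 2 := by
  rw [← sum_cut_singleton_eq_pairWeight, hx.degree]

lemma two_le_sum_cut_pair (hx : IsSubtourFeasible x) {u v : V} (huv : u ≠ v) :
    2 ≤ ∑ e ∈ cut {u, v}, x e := by
  have hu := hx.sum_pairWeight u
  have hv := hx.sum_pairWeight v
  rw [← Finset.sum_add_sum_compl {u, v}, Finset.sum_pair huv, pairWeight_self] at hu hv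
  rw [pairWeight_symm] at hv
  have hle := hx.pairWeight_le_one u v
  rw [sum_cut_eq_pairWeight, Finset.sum_pair huv]
  linarith

lemma two_le_sum_cut_of_card_le_two (hx : IsSubtourFeasible x) {S : Finset V} (hS : S.Nonempty)
    (hcard : S.card ≤ 2) : 2 ≤ ∑ e ∈ cut S, x e := by
  rcases (by have := hS.card_pos; omega : S.card = 1 ∨ S.card = 2) with hone | htwo
  · obtain ⟨u, rfl⟩ := Finset.card_eq_one.1 hone
    exact (hx.degree u).ge
  · obtain ⟨u, v, huv, rfl⟩ := Finset.card_eq_two.1 htwo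
    exact hx.two_le_sum_cut_pair huv

lemma two_le_sum_cut (hx : IsSubtourFeasible x) {S : Finset V} (hS : S.Nonempty)
    (hne : S ≠ Finset.univ) : 2 ≤ ∑ e ∈ cut S, x e := by
  have hcompl := S.card_add_card_compl
  by_cases hsmall : S.card ≤ 2
  · exact hx.two_le_sum_cut_of_card_le_two hS hsmall
  by_cases hlarge : Sᶜ.card ≤ 2
  · rw [← sum_cut_compl]
    exact hx.two_le_sum_cut_of_card_le_two
      (Finset.nonempty_iff_ne_empty.2 fun h => hne (Finset.compl_eq_empty_iff _ |>.1 h)) hlarge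
  · exact hx.subtour S (by omega) (by omega)

lemma isFracTour (hx : IsSubtourFeasible x) : IsFracTour (pairWeight x) where
  symm := pairWeight_symm x
  nonneg := hx.pairWeight_nonneg
  le_one := hx.pairWeight_le_one
  self := pairWeight_self x
  degree := hx.sum_pairWeight
  cut S hS hne := by
    rw [← sum_cut_eq_pairWeight]
    exact hx.two_le_sum_cut hS hne

lemma lpCost_eq (hx : IsSubtourFeasible x) {c : Sym2 V → ℝ}
    (hc : ∀ e ∈ edges V, c e = 1 ∨ c e = 2) :
    lpCost c x = Fintype.card V + nonEdgeWeight (costOneGraph c) (pairWeight x) := by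
  simp only [nonEdgeWeight, weightOff_costOneGraph hc, Finset.sum_sub_distrib, sum_sum_pairWeight]
  simp only [← sum_sum_pairWeight x, hx.sum_pairWeight, Finset.sum_const, Finset.card_univ,
    nsmul_eq_mul, lpCost]
  ring

lemma eq_one_of_card_eq_three (hx : IsSubtourFeasible x) (hcard : Fintype.card V = 3) {e : Sym2 V}
    (he : e ∈ edges V) : x e = 1 := by
  refine le_antisymm (hx.bounds e he).2 ?_
  induction e with
  | _ a b =>
    have hab := mem_edges_iff.1 he
    have hsum := hx.sum_pairWeight a
    rw [← Finset.sum_add_sum_compl {a, b}, Finset.sum_pair hab, pairWeight_self,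
      pairWeight_of_ne x hab] at hsum
    obtain ⟨d, hd⟩ : ∃ d, ({a, b} : Finset V)ᶜ = {d} :=
      Finset.card_eq_one.1 (by rw [Finset.card_compl, Finset.card_pair hab, hcard])
    rw [hd, Finset.sum_singleton] at hsum
    have := hx.pairWeight_le_one a d
    linarith

lemma congr {y : Sym2 V → ℝ} (hx : IsSubtourFeasible x) (h : ∀ e ∈ edges V, y e = x e) :
    IsSubtourFeasible y := by
  have hsum : ∀ S : Finset V, ∑ e ∈ cut S, y e = ∑ e ∈ cut S, x e :=
    fun S => Finset.sum_congr rfl fun e he => h e (cut_subset_edges S he)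
  refine ⟨fun i => ?_, fun S hS hS' => ?_, fun e he => ?_⟩
  · rw [hsum, hx.degree]
  · rw [hsum]
    exact hx.subtour S hS hS'
  · rw [h e he]
    exact hx.bounds e he

end IsSubtourFeasible

lemma isSubtourFeasible_const (hcard : 3 ≤ Fintype.card V) :
    IsSubtourFeasible (fun _ : Sym2 V => (2 / (Fintype.card V - 1) : ℝ)) := by
  have hn : (3 : ℝ) ≤ Fintype.card V := by exact_mod_cast hcard
  have hpos : (0 : ℝ) < Fintype.card V - 1 := by linarith
  have hsum : ∀ S : Finset V, ∑ e ∈ cut S, (2 / (Fintype.card V - 1) : ℝ) =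
      2 * (S.card * (Fintype.card V - S.card)) / (Fintype.card V - 1) := by
    intro S
    rw [sum_cut S fun _ => (2 / (Fintype.card V - 1) : ℝ)]
    simp only [Finset.sum_const, nsmul_eq_mul, Finset.card_compl]
    rw [Nat.cast_sub (Finset.card_le_univ S)]
    ring
  refine ⟨fun i => ?_, fun S hS hS' => ?_, fun e _ => ⟨by positivity, ?_⟩⟩
  · rw [hsum, Finset.card_singleton, div_eq_iff hpos.ne']
    push_cast
    ring
  · rw [hsum, le_div_iff₀ hpos]
    have hge : (3 : ℝ) ≤ S.card := by exact_mod_cast hS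
    have hle : (S.card : ℝ) + 3 ≤ Fintype.card V := by exact_mod_cast hS'
    nlinarith
  · rw [div_le_one hpos]
    linarith

lemma lpValues_nonempty (c : Sym2 V → ℝ) (hcard : 3 ≤ Fintype.card V) : (lpValues c).Nonempty :=
  ⟨_, _, isSubtourFeasible_const hcard, rfl⟩

lemma isClosed_isSubtourFeasible : IsClosed {x : Sym2 V → ℝ | IsSubtourFeasible x} := by
  have hiff : ∀ x : Sym2 V → ℝ, IsSubtourFeasible x ↔ (∀ i : V, ∑ e ∈ cut {i}, x e = 2) ∧
      (∀ S : Finset V, 3 ≤ S.card → S.card + 3 ≤ Fintype.card V → 2 ≤ ∑ e ∈ cut S, x e) ∧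
      ∀ e ∈ edges V, 0 ≤ x e ∧ x e ≤ 1 :=
    fun x => ⟨fun h => ⟨h.degree, h.subtour, h.bounds⟩, fun h => ⟨h.1, h.2.1, h.2.2⟩⟩
  simp only [hiff, Set.ofPred_and, Set.ofPred_forall]
  refine .inter ?_ (.inter ?_ ?_)
  · exact isClosed_iInter fun i => isClosed_eq (by fun_prop) (by fun_prop)
  · exact isClosed_iInter fun S => isClosed_iInter fun _ => isClosed_iInter fun _ =>
      isClosed_le (by fun_prop) (by fun_prop)
  · exact isClosed_iInter fun e => isClosed_iInter fun _ =>
      (isClosed_le (by fun_prop) (by fun_prop)).inter (isClosed_le (by fun_prop) (by fun_prop))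

lemma isCompact_isSubtourFeasible :
    IsCompact {x : Sym2 V → ℝ | IsSubtourFeasible x ∧ ∀ e ∉ edges V, x e = 0} := by
  have hzero : IsClosed {x : Sym2 V → ℝ | ∀ e ∉ edges V, x e = 0} := by
    simp only [Set.ofPred_forall]
    exact isClosed_iInter fun e => isClosed_iInter fun _ => isClosed_eq (by fun_prop) (by fun_prop)
  refine (isCompact_univ_pi fun _ => isCompact_Icc (a := (0 : ℝ)) (b := 1)).of_isClosed_subset
    (isClosed_isSubtourFeasible.inter hzero) ?_
  rintro x ⟨hx, hx0⟩ e -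
  by_cases he : e ∈ edges V
  · exact hx.bounds e he
  · rw [hx0 e he]
    exact ⟨le_rfl, zero_le_one⟩

lemma lpValues_eq_image (c : Sym2 V → ℝ) :
    lpValues c = lpCost c '' {x | IsSubtourFeasible x ∧ ∀ e ∉ edges V, x e = 0} := by
  ext t
  constructor
  · rintro ⟨x, hx, rfl⟩
    have h : ∀ e ∈ edges V, (if e ∈ edges V then x e else 0) = x e := fun e he => if_pos he
    refine ⟨fun e => if e ∈ edges V then x e else 0, ⟨hx.congr h, fun e he => if_neg he⟩, ?_⟩
    exact Finset.sum_congr rfl fun e he => congrArg (c e * ·) (h e he)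
  · rintro ⟨x, ⟨hx, -⟩, rfl⟩
    exact ⟨x, hx, rfl⟩

lemma isLeast_optSubtour (c : Sym2 V → ℝ) (hcard : 3 ≤ Fintype.card V) :
    IsLeast (lpValues c) (optSubtour c) := by
  have hcompact : IsCompact (lpValues c) := by
    rw [lpValues_eq_image]
    refine isCompact_isSubtourFeasible.image ?_
    unfold lpCost
    fun_prop
  exact hcompact.isLeast_sInf (lpValues_nonempty c hcard)

end SubtourLP

namespace IsSubtourFeasible

variable {V : Type*} [Fintype V] [DecidableEq V] {c x : Sym2 V → ℝ}

lemma optTour_le_of_card_eq_three (hx : IsSubtourFeasible x) (hcard : Fintype.card V = 3)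
    (hc : ∀ e ∈ edges V, 0 ≤ c e) : optTour c ≤ lpCost c x := by
  obtain ⟨v, p, hp, hcost⟩ := (isLeast_optTour c hcard.ge).1
  calc optTour c = ∑ e ∈ p.edges.toFinset, c e := by rw [← hcost, walkCost_eq_sum c hp]
    _ ≤ ∑ e ∈ edges V, c e := by
      refine Finset.sum_le_sum_of_subset_of_nonneg (fun e he => ?_) fun e he _ => hc e he
      exact SimpleGraph.mem_edgeFinset.2 (p.edges_subset_edgeSet (List.mem_toFinset.1 he))
    _ = lpCost c x :=
      Finset.sum_congr rfl fun e he => by rw [hx.eq_one_of_card_eq_three hcard he, mul_one]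

theorem optTour_le (hx : IsSubtourFeasible x) (hcard : 3 ≤ Fintype.card V)
    (hc : ∀ e ∈ edges V, c e = 1 ∨ c e = 2) : optTour c ≤ 19 / 15 * lpCost c x := by
  have hlp := hx.lpCost_eq hc
  have hoff := hx.isFracTour.nonEdgeWeight_nonneg (costOneGraph c)
  rcases hcard.eq_or_lt with hthree | hfour
  · have hnonneg : ∀ e ∈ edges V, 0 ≤ c e := fun e he => by
      rcases hc e he with h | h <;> norm_num [h]
    have := hx.optTour_le_of_card_eq_three hthree.symm hnonneg
    have : (0 : ℝ) ≤ Fintype.card V := Nat.cast_nonneg _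
    linarith
  · obtain ⟨l, hl, hbreaks⟩ :=
      hx.isFracTour.exists_fifteen_mul_breaks_le (costOneGraph c) hfour
    have := hl.optTour_le hcard hc
    linarith

end IsSubtourFeasible

end OneTwoTSP

theorem mainTheorem1 {V : Type*} [Fintype V] [DecidableEq V] (hV : 3 ≤ Fintype.card V)
    (c : Sym2 V → ℝ) (hc : ∀ e ∈ OneTwoTSP.edges V, c e = 1 ∨ c e = 2) :
    IsLeast (OneTwoTSP.tourCosts c) (OneTwoTSP.optTour c) ∧
    IsLeast (OneTwoTSP.lpValues c) (OneTwoTSP.optSubtour c) ∧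
    OneTwoTSP.optTour c ≤ 19 / 15 * OneTwoTSP.optSubtour c := by
  refine ⟨OneTwoTSP.isLeast_optTour c hV, OneTwoTSP.isLeast_optSubtour c hV, ?_⟩
  obtain ⟨x, hx, hcost⟩ := (OneTwoTSP.isLeast_optSubtour c hV).1
  rw [← hcost]
  exact hx.optTour_le hV hc
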